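/- Concepts are built from countably infinitely many concept names $A$ and role names $r$ by $C,D ::= \top \mid A \mid \neg C \mid C\sqcap D\mid C\sqcup D\mid \exists R.C\mid\forall R.C$ with $R$ a role name or an inverse role $r^-$, with the usual semantics over interpretations with non-empty domain; $\bot=\neg\top$. $\mathcal{ALC}$-concepts use no inverse roles; $\mathcal{EL}$-concepts use only $\top$, concept names, $\sqcap$, and $\exists r.C$. A full conjunctive query (CQ) $q$ is a finite conjunction of atoms $C(x)$, $r(x,y)$ all of whose variables are answer variables; $q(\mathcal I)$ is the set of its answers on an interpretation $\mathcal I$. Fix a countably infinite set of abstraction levels. An ontology with abstraction and refinement is a finite set of statements of the forms $C\sqsubseteq_L D$; $R\sqsubseteq_L S$ (with $R,S$ roles); concept refinements (cr) $L{:}q(\bar x)\ \underline{\mathrm{refines}}\ L'{:}C$; concept abstractions (ca) $L'{:}C\ \underline{\mathrm{abstracts}}\ L{:}q(\bar x)$; role refinements (rr) $L{:}q(\bar x,\bar y)\ \underline{\mathrm{refines}}\ L'{:}(C_1(x)\wedge R(x,y)\wedge C_2(y))$; and role abstractions (ra) $L'{:}R\ \underline{\mathrm{abstracts}}\ L{:}q(\bar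 x,\bar y)$. Here each $q$ is a full CQ, which is connected in abstraction statements, and $\bar x,\bar y$ are non-empty tuples of pairwise distinct variables. For $\mathcal L\in\{\mathcal{ALC},\mathcal{EL}\}$ and a set $X$ of operators among cr, ca, rr, ra, $\mathcal L^{\mathrm{abs}}[X]$ admits only $\mathcal L$-concepts, no inverse roles, no inclusions $R\sqsubseteq_L S$, and, among the refinement and abstraction statements, only those named in $X$. An A-interpretation consists of a set of levels; a relation $\prec$ on it such that the directed graph with edges $(L',L)$ for $L\prec L'$ is a rooted directed tree; an interpretation $\mathcal I_L$ for each of its levels $L$, with pairwise disjoint domains; and a partial function $\rho$ that maps pairs $(d,L)$, with $d$ an object of some level $L'$ and $L\prec L'$, to $L$-ensembles $\rho_L(d)$, i.e. non-empty tuples of objects of level $L$, such that every object occurs in $\rho_{L}(d)$ for at most one object $d$, where $L$ is the level of the occurring object. Under the repetition-free semantics, ensembles are repetition-free tuples: all tuples $\rho_L(d)$ are repetition-free, and abstraction statements speak only about repetition-free tuples. An A-interpretation satisfies a statement if all levels mentioned in it belong to the A-interpretation, $L\prec L'$ holds in case of a refinement or abstraction, and - for $\alpha\sqsubseteq_L\beta$: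 $\alpha^{\mathcal I_L}\subseteq\beta^{\mathcal I_L}$; - for a concept refinement: every $d\in C^{\mathcal I_{L'}}$ has $\rho_L(d)=\bar e$ for some $\bar e\in q(\mathcal I_L)$; - for a concept abstraction: for every repetition-free $\bar e\in q(\mathcal I_L)$ there is $d\in C^{\mathcal I_{L'}}$ with $\rho_L(d)=\bar e$; - for a role refinement: for all $(d_1,d_2)\in R^{\mathcal I_{L'}}$ with $d_1\in C_1^{\mathcal I_{L'}}$, $d_2\in C_2^{\mathcal I_{L'}}$ there is $(\bar e_1,\bar e_2)\in q(\mathcal I_L)$ with $\rho_L(d_1)=\bar e_1$ and $\rho_L(d_2)=\bar e_2$; - for a role abstraction: for every $(\bar e_1,\bar e_2)\in q(\mathcal I_L)$ with $\bar e_1$ and $\bar e_2$ each repetition-free there is $(d_1,d_2)\in R^{\mathcal I_{L'}}$ with $\rho_L(d_1)=\bar e_1$ and $\rho_L(d_2)=\bar e_2$. Satisfiability in $\mathcal L^{\mathrm{abs}}[X]$ is the problem to decide, given an $\mathcal L^{\mathrm{abs}}[X]$-ontology $\mathcal O$, an $\mathcal L$-concept $C$ and a level $L$, whether some such A-interpretation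 satisfies all statements of $\mathcal O$, contains the level $L$, and has $C^{\mathcal I_L}\neq\emptyset$. **Theorem.** Under the repetition-free semantics, satisfiability is undecidable in $\mathcal{ALC}^{\mathrm{abs}}[\mathrm{ca}]$, in $\mathcal{ALC}^{\mathrm{abs}}[\mathrm{ra}]$, in $\mathcal{EL}^{\mathrm{abs}}[\mathrm{rr},\mathrm{ca}]$, and in $\mathcal{EL}^{\mathrm{abs}}[\mathrm{rr},\mathrm{ra}]$. -/

import Mathlib

namespace AbsDL

/-! Concept names, role names, variables and abstraction levels are natural numbers. -/

abbrev ConceptName := ℕ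
abbrev RoleName := ℕ
abbrev Var := ℕ
abbrev Level := ℕ

/-! ### Syntax -/

/-- Roles: role names and their inverses. -/
inductive Role where
  | name (r : RoleName)
  | inv (r : RoleName)

/-- `ALCI`-concepts. The concept `⊤` is kept as a constructor, since it belongs to `EL`,
which has neither negation nor disjunction. -/
inductive Concept where
  | top
  | name (A : ConceptName)
  | neg (C : Concept)
  | conj (C D : Concept)
  | disj (C D : Concept)
  | ex (R : Role) (C : Concept)
  | all (R : Role) (C : Concept)

/-- Atoms `C(x)` and `r(x,y)` of conjunctive queries. -/
inductive Atom where
  | concept (C : Concept) (x : Var)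
  | role (r : RoleName) (x y : Var)

/-- The statements of ontologies with abstraction and refinement. A full conjunctive query is
given by its tuple of answer variables (two tuples `xs`, `ys` in the case of roles) and by the
list of its atoms.
* `ci L C D` is `C ⊑_L D`, and `ri L R S` is `R ⊑_L S`;
* `cr L xs q K C` is `L:q(xs) refines K:C`;
* `ca K C L xs q` is `K:C abstracts L:q(xs)`;
* `rr L xs ys q K C R D` is `L:q(xs,ys) refines K:(C(x) ∧ R(x,y) ∧ D(y))`;
* `ra K R L xs ys q` is `K:R abstracts L:q(xs,ys)`. -/
inductive Statement where
  | ci (L : Level) (C D : Concept)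
  | ri (L : Level) (R S : Role)
  | cr (L : Level) (xs : List Var) (q : List Atom) (K : Level) (C : Concept)
  | ca (K : Level) (C : Concept) (L : Level) (xs : List Var) (q : List Atom)
  | rr (L : Level) (xs ys : List Var) (q : List Atom) (K : Level) (C : Concept) (R : Role)
      (D : Concept)
  | ra (K : Level) (R : Role) (L : Level) (xs ys : List Var) (q : List Atom)

/-- An ontology is a finite set of statements, presented as a list; the semantics below
depends only on which statements are members. -/
abbrev Ontology := List Statement

/-- The variable `v` occurs in the atom. -/
def Atom.HasVar (v : Var) : Atom → Prop
  | .concept _ x => v = x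
  | .role _ x y => v = x ∨ v = y

/-- `q` is a full conjunctive query whose answer variables are, without repetition, the
members of `vs`: the variables of `q` are exactly the answer variables. -/
def IsFullCQ (vs : List Var) (q : List Atom) : Prop :=
  vs.Nodup ∧ ∀ v, v ∈ vs ↔ ∃ α ∈ q, α.HasVar v

/-- The undirected graph of a query: `v` and `w` are joined if some role atom contains them. -/
def queryGraph (q : List Atom) : SimpleGraph Var :=
  SimpleGraph.fromRel fun v w => ∃ r, Atom.role r v w ∈ q

/-- The query `q` with variables `vs` is connected. -/
def IsConnectedCQ (vs : List Var) (q : List Atom) : Prop :=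
  ∀ v ∈ vs, ∀ w ∈ vs, (queryGraph q).Reachable v w

/-- Syntactic well-formedness of statements: queries are full, ensembles are non-empty tuples,
and the queries in abstraction statements are connected. -/
def Statement.WellFormed : Statement → Prop
  | .ci _ _ _ => True
  | .ri _ _ _ => True
  | .cr _ xs q _ _ => xs ≠ [] ∧ IsFullCQ xs q
  | .ca _ _ _ xs q => xs ≠ [] ∧ IsFullCQ xs q ∧ IsConnectedCQ xs q
  | .rr _ xs ys q _ _ _ _ => xs ≠ [] ∧ ys ≠ [] ∧ IsFullCQ (xs ++ ys) q
  | .ra _ _ _ xs ys q =>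
      xs ≠ [] ∧ ys ≠ [] ∧ IsFullCQ (xs ++ ys) q ∧ IsConnectedCQ (xs ++ ys) q

/-! ### Fragments -/

/-- The role is a role name. -/
def Role.IsName : Role → Prop
  | .name _ => True
  | .inv _ => False

/-- `ALC`-concepts: no inverse roles. -/
def Concept.IsALC : Concept → Prop
  | .top => True
  | .name _ => True
  | .neg C => C.IsALC
  | .conj C D => C.IsALC ∧ D.IsALC
  | .disj C D => C.IsALC ∧ D.IsALC
  | .ex R C => R.IsName ∧ C.IsALC
  | .all R C => R.IsName ∧ C.IsALC

/-- `EL`-concepts: built from `⊤` and concept names by conjunction and existential restriction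
over role names. -/
def Concept.IsEL : Concept → Prop
  | .top => True
  | .name _ => True
  | .neg _ => False
  | .conj C D => C.IsEL ∧ D.IsEL
  | .disj _ _ => False
  | .ex R C => R.IsName ∧ C.IsEL
  | .all _ _ => False

/-- All concepts in the atom satisfy `P`. -/
def Atom.Over (P : Concept → Prop) : Atom → Prop
  | .concept C _ => P C
  | .role _ _ _ => True

/-- Concept refinement, concept abstraction, role refinement, role abstraction. -/
inductive Operator where
  | cr
  | ca
  | rr
  | ra

/-- The statement uses only concepts that satisfy `P`, only role names (no inverse roles), no
role inclusions, and only those refinement and abstraction operators that are in `ops`. -/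
def Statement.InFragment (P : Concept → Prop) (ops : Set Operator) : Statement → Prop
  | .ci _ C D => P C ∧ P D
  | .ri _ _ _ => False
  | .cr _ _ q _ C => Operator.cr ∈ ops ∧ P C ∧ ∀ α ∈ q, α.Over P
  | .ca _ C _ _ q => Operator.ca ∈ ops ∧ P C ∧ ∀ α ∈ q, α.Over P
  | .rr _ _ _ q _ C R D =>
      Operator.rr ∈ ops ∧ P C ∧ R.IsName ∧ P D ∧ ∀ α ∈ q, α.Over P
  | .ra _ R _ _ _ q => Operator.ra ∈ ops ∧ R.IsName ∧ ∀ α ∈ q, α.Over P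

/-! ### Semantics -/

/-- Interpretations of the base description logic. -/
structure Interp where
  Dom : Type
  nonempty : Nonempty Dom
  conceptExt : ConceptName → Set Dom
  roleExt : RoleName → Dom → Dom → Prop

/-- Extension of roles. -/
def Interp.evalRole (I : Interp) : Role → I.Dom → I.Dom → Prop
  | .name r, d, e => I.roleExt r d e
  | .inv r, d, e => I.roleExt r e d

/-- Extension of concepts. -/
def Interp.eval (I : Interp) : Concept → Set I.Dom
  | .top => Set.univ
  | .name A => I.conceptExt A
  | .neg C => (I.eval C)ᶜ
  | .conj C D => I.eval C ∩ I.eval D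
  | .disj C D => I.eval C ∪ I.eval D
  | .ex R C => {d | ∃ e, I.evalRole R d e ∧ e ∈ I.eval C}
  | .all R C => {d | ∀ e, I.evalRole R d e → e ∈ I.eval C}

/-- The assignment `h` makes the atom true. -/
def Interp.AtomHolds (I : Interp) (h : Var → I.Dom) : Atom → Prop
  | .concept C x => h x ∈ I.eval C
  | .role r x y => I.roleExt r (h x) (h y)

/-- `h` is a homomorphism from the query `q` to `I`. -/
def Interp.IsHom (I : Interp) (q : List Atom) (h : Var → I.Dom) : Prop :=
  ∀ α ∈ q, I.AtomHolds h α

/-- The answers to `q(xs)` on `I`. -/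
def Interp.answers (I : Interp) (xs : List Var) (q : List Atom) : Set (List I.Dom) :=
  {e | ∃ h, I.IsHom q h ∧ xs.map h = e}

/-- The answers to `q(xs,ys)` on `I`, as pairs of tuples. -/
def Interp.answers₂ (I : Interp) (xs ys : List Var) (q : List Atom) :
    Set (List I.Dom × List I.Dom) :=
  {e | ∃ h, I.IsHom q h ∧ xs.map h = e.1 ∧ ys.map h = e.2}

/-- The directed graph with edge relation `E` is a (rooted, directed) tree: every vertex is
reachable from the root, the root has no predecessor, and every vertex has at most one. -/
def IsDirectedTree {V : Type} (E : V → V → Prop) : Prop :=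
  ∃ root : V, (∀ v, Relation.ReflTransGen E root v) ∧ (∀ u, ¬ E u root) ∧
    ∀ u w v, E u v → E w v → u = w

/-- A-interpretations. `prec L K` says that `L` is less abstract than `K`, and `ref K L d` is
the `L`-ensemble that the object `d` of level `K` refines into, if there is one. The domains of
different levels are disjoint because objects come together with their level. -/
structure AInterp where
  levels : Set Level
  prec : levels → levels → Prop
  tree : IsDirectedTree fun K L => prec L K
  interp : levels → Interp
  ref : (K L : levels) → (interp K).Dom → Option (List (interp L).Dom)
  /-- Refinement goes to direct successors only. -/
  prec_of_ref : ∀ {K L d e}, ref K L d = some e → prec L K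
  /-- Ensembles are non-empty tuples. -/
  ref_ne_nil : ∀ {K L d e}, ref K L d = some e → e ≠ []
  /-- Every object participates in at most one ensemble. -/
  ref_unique : ∀ {L : levels} (a : (interp L).Dom) {K₁ K₂ : levels} {d₁ : (interp K₁).Dom}
    {d₂ : (interp K₂).Dom} {e₁ e₂ : List (interp L).Dom},
    ref K₁ L d₁ = some e₁ → ref K₂ L d₂ = some e₂ → a ∈ e₁ → a ∈ e₂ →
    (⟨K₁, d₁⟩ : Σ K, (interp K).Dom) = ⟨K₂, d₂⟩

/-- All ensembles are repetition-free tuples. -/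
def AInterp.RepetitionFree (I : AInterp) : Prop :=
  ∀ (K L : I.levels) (d : (I.interp K).Dom) (e : List (I.interp L).Dom),
    I.ref K L d = some e → e.Nodup

/-- Satisfaction under the repetition-free semantics, in which only repetition-free tuples are
ensembles: an abstraction statement speaks about those answers to its query that consist of
repetition-free tuples. -/
def AInterp.Satisfies (I : AInterp) : Statement → Prop
  | .ci L C D => ∃ hL : L ∈ I.levels, (I.interp ⟨L, hL⟩).eval C ⊆ (I.interp ⟨L, hL⟩).eval D
  | .ri L R S => ∃ hL : L ∈ I.levels, ∀ d e,
      (I.interp ⟨L, hL⟩).evalRole R d e → (I.interp ⟨L, hL⟩).evalRole S d e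
  | .cr L xs q K C => ∃ (hL : L ∈ I.levels) (hK : K ∈ I.levels), I.prec ⟨L, hL⟩ ⟨K, hK⟩ ∧
      ∀ d ∈ (I.interp ⟨K, hK⟩).eval C, ∃ e ∈ (I.interp ⟨L, hL⟩).answers xs q,
        I.ref ⟨K, hK⟩ ⟨L, hL⟩ d = some e
  | .ca K C L xs q => ∃ (hL : L ∈ I.levels) (hK : K ∈ I.levels), I.prec ⟨L, hL⟩ ⟨K, hK⟩ ∧
      ∀ e ∈ (I.interp ⟨L, hL⟩).answers xs q, e.Nodup →
        ∃ d ∈ (I.interp ⟨K, hK⟩).eval C, I.ref ⟨K, hK⟩ ⟨L, hL⟩ d = some e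
  | .rr L xs ys q K C R D =>
      ∃ (hL : L ∈ I.levels) (hK : K ∈ I.levels), I.prec ⟨L, hL⟩ ⟨K, hK⟩ ∧
      ∀ d₁ d₂, d₁ ∈ (I.interp ⟨K, hK⟩).eval C → (I.interp ⟨K, hK⟩).evalRole R d₁ d₂ →
        d₂ ∈ (I.interp ⟨K, hK⟩).eval D →
        ∃ e ∈ (I.interp ⟨L, hL⟩).answers₂ xs ys q,
          I.ref ⟨K, hK⟩ ⟨L, hL⟩ d₁ = some e.1 ∧ I.ref ⟨K, hK⟩ ⟨L, hL⟩ d₂ = some e.2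
  | .ra K R L xs ys q =>
      ∃ (hL : L ∈ I.levels) (hK : K ∈ I.levels), I.prec ⟨L, hL⟩ ⟨K, hK⟩ ∧
      ∀ e ∈ (I.interp ⟨L, hL⟩).answers₂ xs ys q, e.1.Nodup → e.2.Nodup →
        ∃ d₁ d₂, (I.interp ⟨K, hK⟩).evalRole R d₁ d₂ ∧
          I.ref ⟨K, hK⟩ ⟨L, hL⟩ d₁ = some e.1 ∧ I.ref ⟨K, hK⟩ ⟨L, hL⟩ d₂ = some e.2

/-- The inputs to the satisfiability problem: an ontology, a concept, and a level. -/
structure Instance where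
  ontology : Ontology
  concept : Concept
  level : Level

/-- `C` is `L`-satisfiable with respect to the ontology, under the repetition-free semantics. -/
def Instance.Satisfiable (X : Instance) : Prop :=
  ∃ I : AInterp, I.RepetitionFree ∧ (∀ s ∈ X.ontology, I.Satisfies s) ∧
    ∃ hL : X.level ∈ I.levels, ((I.interp ⟨X.level, hL⟩).eval X.concept).Nonempty

/-- The input belongs to the fragment with concepts satisfying `P` and operators `ops`. -/
def Instance.InFragment (P : Concept → Prop) (ops : Set Operator) (X : Instance) : Prop :=
  (∀ s ∈ X.ontology, s.WellFormed ∧ s.InFragment P ops) ∧ P X.concept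

/-! ### Encoding of inputs as natural numbers -/

/-- Code of a list of natural numbers. -/
def codeList (l : List ℕ) : ℕ := Encodable.encode l

theorem codeList_injective : Function.Injective codeList := Encodable.encode_injective

def Role.code : Role → ℕ
  | .name r => Nat.pair 0 r
  | .inv r => Nat.pair 1 r

def Concept.code : Concept → ℕ
  | .top => Nat.pair 0 0
  | .name A => Nat.pair 1 A
  | .neg C => Nat.pair 2 C.code
  | .conj C D => Nat.pair 3 (Nat.pair C.code D.code)
  | .disj C D => Nat.pair 4 (Nat.pair C.code D.code)
  | .ex R C => Nat.pair 5 (Nat.pair R.code C.code)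
  | .all R C => Nat.pair 6 (Nat.pair R.code C.code)

def Atom.code : Atom → ℕ
  | .concept C x => Nat.pair 0 (Nat.pair C.code x)
  | .role r x y => Nat.pair 1 (Nat.pair r (Nat.pair x y))

def codeQuery (q : List Atom) : ℕ := codeList (q.map Atom.code)

def Statement.code : Statement → ℕ
  | .ci L C D => codeList [0, L, C.code, D.code]
  | .ri L R S => codeList [1, L, R.code, S.code]
  | .cr L xs q K C => codeList [2, L, codeList xs, codeQuery q, K, C.code]
  | .ca K C L xs q => codeList [3, K, C.code, L, codeList xs, codeQuery q]
  | .rr L xs ys q K C R D =>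
      codeList [4, L, codeList xs, codeList ys, codeQuery q, K, C.code, R.code, D.code]
  | .ra K R L xs ys q => codeList [5, K, R.code, L, codeList xs, codeList ys, codeQuery q]

def Instance.code (X : Instance) : ℕ :=
  codeList [codeList (X.ontology.map Statement.code), X.concept.code, X.level]

theorem Role.code_injective : Function.Injective Role.code := by
  intro R S h
  cases R <;> cases S <;> simp_all [Role.code, Nat.pair_eq_pair]

theorem Concept.code_injective : Function.Injective Concept.code := by
  intro C
  induction C with
  | top => intro D h; cases D <;> simp_all [Concept.code, Nat.pair_eq_pair]
  | name A => intro D h; cases D <;> simp_all [Concept.code, Nat.pair_eq_pair]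
  | neg C ih =>
    intro D h
    cases D <;> simp [Concept.code, Nat.pair_eq_pair] at h ⊢
    exact ih h
  | conj C₁ C₂ ih₁ ih₂ =>
    intro D h
    cases D <;> simp [Concept.code, Nat.pair_eq_pair] at h ⊢
    exact ⟨ih₁ h.1, ih₂ h.2⟩
  | disj C₁ C₂ ih₁ ih₂ =>
    intro D h
    cases D <;> simp [Concept.code, Nat.pair_eq_pair] at h ⊢
    exact ⟨ih₁ h.1, ih₂ h.2⟩
  | ex R C ih =>
    intro D h
    cases D <;> simp [Concept.code, Nat.pair_eq_pair] at h ⊢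
    exact ⟨Role.code_injective h.1, ih h.2⟩
  | all R C ih =>
    intro D h
    cases D <;> simp [Concept.code, Nat.pair_eq_pair] at h ⊢
    exact ⟨Role.code_injective h.1, ih h.2⟩

theorem Atom.code_injective : Function.Injective Atom.code := by
  intro α β h
  cases α <;> cases β <;>
    simp_all [Atom.code, Nat.pair_eq_pair, Concept.code_injective.eq_iff]

theorem codeQuery_injective : Function.Injective codeQuery :=
  codeList_injective.comp (List.map_injective_iff.mpr Atom.code_injective)

theorem Statement.code_injective : Function.Injective Statement.code := by
  intro s t h
  cases s <;> cases t <;>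
    simp_all [Statement.code, codeList_injective.eq_iff, Concept.code_injective.eq_iff,
      Role.code_injective.eq_iff, codeQuery_injective.eq_iff]

/-- Different inputs have different codes. -/
theorem Instance.code_injective : Function.Injective Instance.code := by
  rintro ⟨O₁, C₁, L₁⟩ ⟨O₂, C₂, L₂⟩ h
  simp only [Instance.code, codeList_injective.eq_iff, List.cons.injEq, and_true,
    (List.map_injective_iff.mpr Statement.code_injective).eq_iff,
    Concept.code_injective.eq_iff] at h
  simp [h]

/-- Satisfiability under the repetition-free semantics is decidable in the fragment with
concepts satisfying `P` and operators `ops`: some algorithm decides it on the codes of all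
inputs that belong to the fragment. -/
def SatDecidable (P : Concept → Prop) (ops : Set Operator) : Prop :=
  ∃ p : ℕ → Prop, ComputablePred p ∧
    ∀ X : Instance, X.InFragment P ops → (p X.code ↔ X.Satisfiable)

end AbsDL

namespace AbsDL

/-! ### Programs on binary trees -/

/-! Non-termination of a program on a given input is reduced to satisfiability. A small loop
language on binary trees is Turing complete, so it contains a program `u` with undecidable domain
(`exists_program_not_computablePred`). Objects at level `0` stand for trees, and each subprogram of
`u` becomes a role that leads from an argument to its value.

Two kinds of axioms describe the roles. Inclusions say that a value exists as soon as the values of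
the relevant subcomputations exist, so roles may stay undefined on diverging arguments. Equations
say that a composition of two roles agrees with a third, possibly under a condition. Inclusions are
plain `EL`; equations are where the repetition-free semantics enters. An abstraction statement only
concerns tuples without repetition, so if its abstract side is empty, it forbids matches in which
all variables take distinct values. Applied to a match of `r(x,y)`, `s(y,z)`, `u(x,z')`, this yields
`z = z'`, provided that no other variables can coincide. To ensure this, each object gets one of
three disjoint tags: `x`, `y` and the pair `z`, `z'` have different ones. Equations are thus
available only along objects with three distinct tags, and the program `id` serves to move a value
to another tag.

If `u` diverges on the input, the trees paired with tags form a model (`Program.isModel_ofInput`).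
Conversely, in every model the axioms force each terminating computation to be carried out
(`Program.IsModel.exists_rep_of_ev`), which contradicts the axiom that `u` has no value at the start
(`Program.IsModel.not_ev`).

It remains to make the abstract side empty. In `ALC` this is an inclusion with negation. In `EL`,
two role refinements ask for ensembles of lengths one and two for the same object, so the role in
question must be empty at level `1` (`emptiesRole_EL`). The abstractions then carry emptiness down
to level `0` and exclude violations (`forbidsViolations_ca`, `forbidsViolations_ra`). All four cases
are instances of `not_satDecidable`. -/

/-- Binary trees. -/
inductive BTree where
  | leaf
  | node (l r : BTree)

/-- Programs that compute partial functions on binary trees. -/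
inductive Program where
  | id
  | leaf
  | fst
  | snd
  | pair (f g : Program)
  | comp (f g : Program)
  | ite (p f g : Program)
  | loop (p f : Program)

/-- Big-step semantics of programs. The projections map `leaf` to `leaf`; `ite p f g` runs `f` if
`p` returns `leaf`, and `g` otherwise; `loop p f` iterates `f` until `p` returns `leaf`. -/
inductive Ev : Program → BTree → BTree → Prop
  | id (t) : Ev .id t t
  | leaf (t) : Ev .leaf t .leaf
  | fst_leaf : Ev .fst .leaf .leaf
  | fst_node (l r) : Ev .fst (.node l r) l
  | snd_leaf : Ev .snd .leaf .leaf
  | snd_node (l r) : Ev .snd (.node l r) r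
  | pair {f g t l r} : Ev f t l → Ev g t r → Ev (.pair f g) t (.node l r)
  | comp {f g t s u} : Ev g t s → Ev f s u → Ev (.comp f g) t u
  | ite_leaf {p f g t s} : Ev p t .leaf → Ev f t s → Ev (.ite p f g) t s
  | ite_node {p f g t l r s} : Ev p t (.node l r) → Ev g t s → Ev (.ite p f g) t s
  | loop_leaf {p f t} : Ev p t .leaf → Ev (.loop p f) t t
  | loop_node {p f t l r s u} :
      Ev p t (.node l r) → Ev f t s → Ev (.loop p f) s u → Ev (.loop p f) t u

/-- Determinism is what makes the equations true in the intended model; it also allows a run of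
compiled code to be compared with a known one. -/
theorem Ev.unique {c : Program} {t s s' : BTree} (h : Ev c t s) (h' : Ev c t s') : s = s' := by
  induction h generalizing s' with
  | id | leaf | fst_leaf | fst_node | snd_leaf | snd_node => cases h'; rfl
  | pair _ _ ih₁ ih₂ => cases h' with | pair h₁ h₂ => rw [ih₁ h₁, ih₂ h₂]
  | comp _ _ ih₁ ih₂ => cases h' with | comp h₁ h₂ => cases ih₁ h₁; exact ih₂ h₂
  | ite_leaf _ _ ih₁ ih₂ =>
    cases h' with
    | ite_leaf h₁ h₂ => exact ih₂ h₂
    | ite_node h₁ h₂ => cases ih₁ h₁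
  | ite_node _ _ ih₁ ih₂ =>
    cases h' with
    | ite_leaf h₁ h₂ => cases ih₁ h₁
    | ite_node h₁ h₂ => exact ih₂ h₂
  | loop_leaf _ ih₁ =>
    cases h' with
    | loop_leaf h₁ => rfl
    | loop_node h₁ => cases ih₁ h₁
  | loop_node _ _ _ ih₁ ih₂ ih₃ =>
    cases h' with
    | loop_leaf h₁ => cases ih₁ h₁
    | loop_node h₁ h₂ h₃ => cases ih₂ h₂; exact ih₃ h₃

/-! ### Compilation of partial recursive functions into programs -/

/-- Unary numerals. -/
def BTree.num : ℕ → BTree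
  | 0 => .leaf
  | n + 1 => .node .leaf (num n)

/-- Lists of natural numbers as trees. -/
def BTree.list : List ℕ → BTree
  | [] => .leaf
  | n :: v => .node (num n) (list v)

open BTree

/-- On the empty list the convention that projections fix `leaf` matches the default head `0`. -/
theorem ev_fst_list (v : List ℕ) : Ev .fst (list v) (num v.headI) := by
  cases v <;> constructor

theorem ev_snd_list (v : List ℕ) : Ev .snd (list v) (list v.tail) := by
  cases v <;> constructor

theorem ev_snd_num (n : ℕ) : Ev .snd (num n) (num n.pred) := by
  cases n <;> constructor

open Turing in
/-- Compilation of codes for partial recursive functions on lists. -/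
def Program.ofCode : ToPartrec.Code → Program
  | .zero' => .pair .leaf .id
  | .succ => .pair (.pair .leaf .fst) .leaf
  | .tail => .snd
  | .cons f fs => .pair (.comp .fst (ofCode f)) (ofCode fs)
  | .comp f g => .comp (ofCode f) (ofCode g)
  | .case f g =>
    .ite .fst (.comp (ofCode f) .snd) (.comp (ofCode g) (.pair (.comp .snd .fst) .snd))
  | .fix f => .comp .snd (.comp (.loop .fst (.comp (ofCode f) .snd)) (ofCode f))

open Turing in
-- One unfolding of the fixed point, free of the sum type in its definition: a head `0` in the
-- output of `f` means stop.
theorem mem_fix_eval {f : ToPartrec.Code} {v w : List ℕ} :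
    w ∈ (ToPartrec.Code.fix f).eval v ↔ ∃ u ∈ f.eval v,
      (u.headI = 0 ∧ w = u.tail) ∨ (u.headI ≠ 0 ∧ w ∈ (ToPartrec.Code.fix f).eval u.tail) := by
  have key := PFun.mem_fix_iff (a := v) (b := w) (f := fun v => (f.eval v).map fun v =>
    if v.headI = 0 then Sum.inl v.tail else Sum.inr v.tail)
  simp only [Part.mem_map_iff] at key
  rw [ToPartrec.Code.fix_eval]
  refine Iff.trans key ?_
  constructor
  · rintro (⟨u, hu, h⟩ | ⟨a, ⟨u, hu, h⟩, hw⟩)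
    · by_cases h0 : u.headI = 0
      · exact ⟨u, hu, .inl ⟨h0, by simpa [h0] using h.symm⟩⟩
      · simp [h0] at h
    · by_cases h0 : u.headI = 0
      · simp [h0] at h
      · simp only [h0, if_false, Sum.inr.injEq] at h
        exact ⟨u, hu, .inr ⟨h0, h ▸ hw⟩⟩
  · rintro ⟨u, hu, ⟨h0, rfl⟩ | ⟨h0, hw⟩⟩
    · exact .inl ⟨u, hu, by simp [h0]⟩
    · exact .inr ⟨u.tail, ⟨u, hu, by simp [h0]⟩, hw⟩

open Turing in
theorem mem_comp_eval {f g : ToPartrec.Code} {v w : List ℕ} :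
    w ∈ (ToPartrec.Code.comp f g).eval v ↔ ∃ u ∈ g.eval v, w ∈ f.eval u := by
  rw [ToPartrec.Code.comp_eval]
  exact Part.mem_bind_iff

open Turing in
theorem case_eval_zero {f g : ToPartrec.Code} {v : List ℕ} (h : v.headI = 0) :
    (ToPartrec.Code.case f g).eval v = f.eval v.tail := by
  simp only [ToPartrec.Code.case_eval, h]
  rfl

open Turing in
theorem case_eval_succ {f g : ToPartrec.Code} {v : List ℕ} {n : ℕ} (h : v.headI = n + 1) :
    (ToPartrec.Code.case f g).eval v = g.eval (n :: v.tail) := by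
  simp only [ToPartrec.Code.case_eval, h]

theorem num_eq_leaf {n : ℕ} : num n = .leaf ↔ n = 0 := by
  cases n <;> simp [num]

theorem num_of_ne_zero {n : ℕ} (h : n ≠ 0) : num n = .node .leaf (num n.pred) := by
  cases n <;> simp_all [num]

open Turing in
-- The compiled loop runs one call of `f` ahead: its state is the latest output of `f`, whose head
-- is the loop test and whose tail is the next argument.
theorem ev_ofCode_fix {f : ToPartrec.Code}
    (ih : ∀ v w, w ∈ f.eval v → Ev (.ofCode f) (list v) (list w)) {v w : List ℕ}
    (h : w ∈ (ToPartrec.Code.fix f).eval v) :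
    Ev (.ofCode (.fix f)) (list v) (list w) := by
  have h' := h
  rw [ToPartrec.Code.fix_eval] at h'
  -- Here `u` is the state on entering the loop and `x` the state on leaving it.
  suffices H : ∃ u x, u ∈ f.eval v ∧
      Ev (.loop .fst (.comp (.ofCode f) .snd)) (list u) (list x) ∧ x.tail = w by
    obtain ⟨u, x, hu, hx, rfl⟩ := H
    exact .comp (.comp (ih _ _ hu) hx) (ev_snd_list x)
  revert h
  refine PFun.fixInduction (C := fun v => w ∈ (ToPartrec.Code.fix f).eval v → ∃ u x,
    u ∈ f.eval v ∧ Ev (.loop .fst (.comp (.ofCode f) .snd)) (list u) (list x) ∧ x.tail = w) h' ?_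
  intro a _ IH h
  obtain ⟨u, hu, ⟨h0, rfl⟩ | ⟨h0, hw⟩⟩ := mem_fix_eval.1 h
  · refine ⟨u, u, hu, .loop_leaf ?_, rfl⟩
    have := ev_fst_list u
    rwa [num_eq_leaf.2 h0] at this
  · obtain ⟨u', x, hu', hx, rfl⟩ := IH u.tail
      (by rw [Part.mem_map_iff]; exact ⟨u, hu, by simp [h0]⟩) hw
    have := ev_fst_list u
    rw [num_of_ne_zero h0] at this
    exact ⟨u, x, hu, .loop_node this (.comp (ev_snd_list u) (ih _ _ hu')) hx, rfl⟩

open Turing in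
theorem ev_ofCode {c : ToPartrec.Code} {v w : List ℕ} (h : w ∈ c.eval v) :
    Ev (.ofCode c) (list v) (list w) := by
  induction c generalizing v w with
  | zero' =>
    simp only [ToPartrec.Code.zero'_eval, Part.pure_eq_some, Part.mem_some_iff] at h
    subst h
    exact .pair (.leaf _) (.id _)
  | succ =>
    simp only [ToPartrec.Code.succ_eval, Part.pure_eq_some, Part.mem_some_iff] at h
    subst h
    exact .pair (.pair (.leaf _) (ev_fst_list v)) (.leaf _)
  | tail =>
    simp only [ToPartrec.Code.tail_eval, Part.pure_eq_some, Part.mem_some_iff] at h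
    subst h
    exact ev_snd_list v
  | cons f fs ihf ihfs =>
    simp only [ToPartrec.Code.cons_eval, Part.bind_eq_bind, Part.mem_bind_iff,
      Part.pure_eq_some, Part.mem_some_iff] at h
    obtain ⟨x, hx, y, hy, rfl⟩ := h
    exact .pair (.comp (ihf hx) (ev_fst_list x)) (ihfs hy)
  | comp f g ihf ihg =>
    obtain ⟨x, hx, hw⟩ := mem_comp_eval.1 h
    exact .comp (ihg hx) (ihf hw)
  | case f g ihf ihg =>
    have hd := ev_fst_list v
    rcases hn : v.headI with _ | n
    · rw [case_eval_zero hn] at h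
      rw [hn] at hd
      exact .ite_leaf hd (.comp (ev_snd_list v) (ihf h))
    · rw [case_eval_succ hn] at h
      rw [hn] at hd
      exact .ite_node hd (.comp (.pair (.comp hd (ev_snd_num _)) (ev_snd_list v)) (ihg h))
  | fix f ihf => exact ev_ofCode_fix (fun _ _ => ihf) h

open Turing in
-- Converse for loops, by induction on the run. The invariant is that the state `u` is the output of
-- `f` on the current argument `v` of the fixed point.
theorem exists_of_ev_loop {f : ToPartrec.Code}
    (ih : ∀ v t, Ev (.ofCode f) (list v) t → ∃ w ∈ f.eval v, t = list w) {p : Program}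
    {t s : BTree} (h : Ev p t s) (hp : p = .loop .fst (.comp (.ofCode f) .snd)) {u v : List ℕ}
    (ht : t = list u) (hu : u ∈ f.eval v) :
    ∃ x, s = list x ∧ x.tail ∈ (ToPartrec.Code.fix f).eval v := by
  induction h generalizing u v with
  | id | leaf | fst_leaf | fst_node | snd_leaf | snd_node | pair | comp | ite_leaf | ite_node =>
    cases hp
  | loop_leaf h₁ =>
    cases hp
    subst ht
    have := h₁.unique (ev_fst_list u)
    exact ⟨u, rfl, mem_fix_eval.2 ⟨u, hu, .inl ⟨num_eq_leaf.1 this.symm, rfl⟩⟩⟩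
  | loop_node h₁ h₂ _ _ _ ih₃ =>
    cases hp
    subst ht
    have h0 : u.headI ≠ 0 := fun h0 => by
      have := h₁.unique (ev_fst_list u)
      rw [num_eq_leaf.2 h0] at this
      cases this
    cases h₂ with
    | comp h₂ h₂' =>
      cases h₂.unique (ev_snd_list u)
      obtain ⟨w, hw, rfl⟩ := ih _ _ h₂'
      obtain ⟨x, rfl, hx⟩ := ih₃ rfl rfl hw
      exact ⟨x, rfl, mem_fix_eval.2 ⟨u, hu, .inr ⟨h0, hx⟩⟩⟩

open Turing in
-- Together with `ev_ofCode` this shows that compilation preserves the domain exactly: a compiled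
-- program never terminates where the code diverges.
theorem exists_of_ev_ofCode {c : ToPartrec.Code} {v : List ℕ} {t : BTree}
    (h : Ev (.ofCode c) (list v) t) : ∃ w ∈ c.eval v, t = list w := by
  induction c generalizing v t with
  | zero' =>
    refine ⟨0 :: v, by simp, h.unique (.pair (.leaf _) (.id _))⟩
  | succ =>
    exact ⟨[v.headI.succ], by simp, h.unique (.pair (.pair (.leaf _) (ev_fst_list v)) (.leaf _))⟩
  | tail => exact ⟨v.tail, by simp, h.unique (ev_snd_list v)⟩
  | cons f fs ihf ihfs =>
    cases h with
    | pair h₁ h₂ =>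
      cases h₁ with
      | comp h₁ h₁' =>
        obtain ⟨x, hx, rfl⟩ := ihf h₁
        obtain ⟨y, hy, rfl⟩ := ihfs h₂
        cases h₁'.unique (ev_fst_list x)
        refine ⟨x.headI :: y, ?_, rfl⟩
        simp only [ToPartrec.Code.cons_eval, Part.bind_eq_bind, Part.mem_bind_iff,
          Part.pure_eq_some, Part.mem_some_iff]
        exact ⟨x, hx, y, hy, rfl⟩
  | comp f g ihf ihg =>
    cases h with
    | comp h₁ h₂ =>
      obtain ⟨x, hx, rfl⟩ := ihg h₁
      obtain ⟨w, hw, rfl⟩ := ihf h₂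
      exact ⟨w, mem_comp_eval.2 ⟨x, hx, hw⟩, rfl⟩
  | case f g ihf ihg =>
    have hd := ev_fst_list v
    cases h with
    | ite_leaf h₁ h₂ =>
      have h0 := num_eq_leaf.1 (hd.unique h₁)
      cases h₂ with
      | comp h₂ h₃ =>
        cases h₂.unique (ev_snd_list v)
        rw [case_eval_zero h0]
        exact ihf h₃
    | ite_node h₁ h₂ =>
      rcases hn : v.headI with _ | n
      · rw [hn] at hd
        cases hd.unique h₁
      · rw [hn] at hd
        cases h₂ with
        | comp h₂ h₃ =>
          cases h₂.unique (.pair (.comp hd (ev_snd_num _)) (ev_snd_list v))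
          rw [case_eval_succ hn]
          exact ihg (v := n :: v.tail) h₃
  | fix f ihf =>
    cases h with
    | comp h₁ h₂ =>
      cases h₁ with
      | comp h₁ h₃ =>
        obtain ⟨u, hu, rfl⟩ := ihf h₁
        obtain ⟨x, rfl, hx⟩ := exists_of_ev_loop (fun _ _ => ihf) h₃ rfl rfl hu
        exact ⟨x.tail, hx, h₂.unique (ev_snd_list x)⟩

/-- Some program has an undecidable domain. -/
theorem exists_program_not_computablePred :
    ∃ c : Program, ¬ ComputablePred fun m : ℕ => ∃ t, Ev c (list [m]) t := by
  -- The universal function at argument `0`; its domain is the halting problem.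
  have hf : Partrec fun n : ℕ => Nat.Partrec.Code.eval (Denumerable.ofNat Nat.Partrec.Code n) 0 :=
    Nat.Partrec.Code.eval_part.comp (Computable.ofNat _) (Computable.const 0)
  obtain ⟨c, hc⟩ := Turing.ToPartrec.Code.exists_code (Nat.Partrec'.part_iff₁.2 hf)
  refine ⟨.ofCode c, fun h => ComputablePred.halting_problem 0 ?_⟩
  refine ComputablePred.computable_of_manyOneReducible ⟨Encodable.encode, Computable.encode, ?_⟩ h
  intro d
  have hd : c.eval [Encodable.encode d] = pure <$> Nat.Partrec.Code.eval d 0 := by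
    refine (hc (Encodable.encode d ::ᵥ List.Vector.nil)).trans ?_
    simp
  have key : (∃ t, Ev (.ofCode c) (list [Encodable.encode d]) t) ↔
      (c.eval [Encodable.encode d]).Dom := by
    rw [Part.dom_iff_mem]
    exact ⟨fun ⟨t, ht⟩ => (exists_of_ev_ofCode ht).imp fun _ h => h.1,
      fun ⟨w, hw⟩ => ⟨_, ev_ofCode hw⟩⟩
  rw [key, hd]
  rfl

/-! ### Axioms for programs -/

/-- Role name `0` is reserved for `botConcept`. -/
def Program.roleName : Program → RoleName
  | .id => Nat.pair 0 0 + 1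
  | .leaf => Nat.pair 1 0 + 1
  | .fst => Nat.pair 2 0 + 1
  | .snd => Nat.pair 3 0 + 1
  | .pair f g => Nat.pair 4 (Nat.pair f.roleName g.roleName) + 1
  | .comp f g => Nat.pair 5 (Nat.pair f.roleName g.roleName) + 1
  | .ite p f g => Nat.pair 6 (Nat.pair p.roleName (Nat.pair f.roleName g.roleName)) + 1
  | .loop p f => Nat.pair 7 (Nat.pair p.roleName f.roleName) + 1

theorem Program.roleName_ne_zero (c : Program) : c.roleName ≠ 0 := by
  cases c <;> simp [roleName]

/-- Needed so that, in the intended model, the role of a program is the graph of that program alone.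
-/
theorem Program.roleName_injective : Function.Injective Program.roleName := by
  intro c
  induction c with
  | id | leaf | fst | snd =>
    intro d h; cases d <;> simp_all [roleName, Nat.pair_eq_pair]
  | pair _ _ ih₁ ih₂ | comp _ _ ih₁ ih₂ | loop _ _ ih₁ ih₂ =>
    intro d h
    cases d <;> simp [roleName, Nat.pair_eq_pair] at h ⊢
    exact ⟨ih₁ h.1, ih₂ h.2⟩
  | ite _ _ _ ih₁ ih₂ ih₃ =>
    intro d h
    cases d <;> simp [roleName, Nat.pair_eq_pair] at h ⊢
    exact ⟨ih₁ h.1, ih₂ h.2.1, ih₃ h.2.2⟩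

/-- The subprograms of a program, including the program itself. -/
def Program.subs : Program → List Program
  | .id => [.id]
  | .leaf => [.leaf]
  | .fst => [.fst]
  | .snd => [.snd]
  | .pair f g => .pair f g :: (f.subs ++ g.subs)
  | .comp f g => .comp f g :: (f.subs ++ g.subs)
  | .ite p f g => .ite p f g :: (p.subs ++ (f.subs ++ g.subs))
  | .loop p f => .loop p f :: (p.subs ++ f.subs)

theorem Program.self_mem_subs (c : Program) : c ∈ c.subs := by
  cases c <;> simp [subs]

/-- The programs whose axioms are used in the simulation of a program. -/
def Program.support (c : Program) : List Program :=
  [.id, .leaf, .fst, .snd] ++ c.subs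

theorem Program.id_mem_support {u : Program} : Program.id ∈ u.support := by simp [support]

theorem Program.fst_mem_support {u : Program} : Program.fst ∈ u.support := by simp [support]

theorem Program.snd_mem_support {u : Program} : Program.snd ∈ u.support := by simp [support]

/-- Every object carries one of three tags. They serve to keep the objects in a match of a query
distinct. -/
abbrev tagConcept (a : Fin 3) : Concept := .name a

/-- Marks the objects that represent `leaf`. -/
abbrev leafConcept : Concept := .name 3

/-- Marks the objects that represent trees other than `leaf`. -/
abbrev nodeConcept : Concept := .name 4

/-- Marks the object that represents the input. -/
abbrev startConcept : Concept := .name 5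

/-- The concept `∃c.C`. -/
abbrev Program.ex (c : Program) (C : Concept) : Concept := .ex (.name c.roleName) C

/-- A concept that is forced to be empty. -/
abbrev botConcept : Concept := .ex (.name 0) .top

/-- The pair `(C, D)` stands for the inclusions `T ⊓ C ⊑ ∃c.(T' ⊓ D)`, with tags `T`, `T'`. -/
def Program.existential : Program → List (Concept × Concept)
  | .id => [(leafConcept, leafConcept), (nodeConcept, nodeConcept)]
  | .leaf => [(.top, leafConcept)]
  | .fst => [(leafConcept, leafConcept), (.top, .top)]
  | .snd => [(leafConcept, leafConcept), (.top, .top)]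
  | .pair f g => [(.conj (f.ex .top) (g.ex .top), nodeConcept)]
  | .comp f g => [(g.ex (f.ex .top), .top)]
  | .ite p f g =>
    [(.conj (p.ex leafConcept) (f.ex .top), .top), (.conj (p.ex nodeConcept) (g.ex .top), .top)]
  | .loop p f =>
    [(p.ex leafConcept, .top),
      (.conj (p.ex nodeConcept) (f.ex (Program.ex (.loop p f) .top)), .top)]

/-- The entry `(C, r, s, u)` says that, on `C`, the composition of `r` and `s` coincides
with `u`. -/
def Program.equational : Program → List (Concept × Program × Program × Program)
  | .id => []
  | .leaf => []
  | .fst => [(.top, .id, .fst, .fst), (.top, .fst, .id, .fst)]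
  | .snd => [(.top, .id, .snd, .snd), (.top, .snd, .id, .snd)]
  | .pair f g => [(.top, .pair f g, .fst, f), (.top, .pair f g, .snd, g)]
  | .comp f g => [(.top, g, f, .comp f g)]
  | .ite p f g => [(p.ex leafConcept, f, .id, .ite p f g), (p.ex nodeConcept, g, .id, .ite p f g)]
  | .loop p f =>
    [(p.ex leafConcept, .id, .id, .loop p f), (p.ex nodeConcept, f, .loop p f, .loop p f)]

/-- The query that matches the violations of an equation, in variables that carry the tags
`a`, `c`, `b`, `b`. -/
def violation (e : Concept × Program × Program × Program) (a b c : Fin 3) : List Atom :=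
  [.concept (.conj e.1 (tagConcept a)) 0, .concept (tagConcept c) 1, .concept (tagConcept b) 2,
    .concept (tagConcept b) 3, .role e.2.1.roleName 0 1, .role e.2.2.1.roleName 1 2,
    .role e.2.2.2.roleName 0 3]

/-- Models of the axioms of the program `u` in which `u` is undefined on the input. -/
structure Program.IsModel (u : Program) (J : Interp) : Prop where
  existential : ∀ d ∈ u.support, ∀ p ∈ d.existential, ∀ a b : Fin 3,
    J.eval (.conj (tagConcept a) p.1) ⊆ J.eval (d.ex (.conj (tagConcept b) p.2))
  equational : ∀ d ∈ u.support, ∀ e ∈ d.equational, ∀ a b c : Fin 3, a ≠ b → c ≠ a → c ≠ b →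
    ∀ h, J.IsHom (violation e a b c) h → h 2 = h 3
  undefined : J.eval (.conj startConcept (u.ex .top)) ⊆ ∅
  disjoint : ∀ a b : Fin 3, a ≠ b → J.eval (.conj (tagConcept a) (tagConcept b)) ⊆ ∅
  role_zero : ∀ x y, ¬ J.roleExt 0 x y

/-! ### The intended model -/

/-- The objects are trees with a tag; the tree `t₀` is the input. -/
def Interp.ofInput (t₀ : BTree) : Interp where
  Dom := BTree × Fin 3
  nonempty := ⟨(.leaf, 0)⟩
  conceptExt A := {x | A = x.2 ∨ (A = 3 ∧ x.1 = .leaf) ∨ (A = 4 ∧ x.1 ≠ .leaf) ∨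
    (A = 5 ∧ x.1 = t₀)}
  roleExt r x y := ∃ c : Program, c.roleName = r ∧ Ev c x.1 y.1

section ofInput

variable {t₀ : BTree}

theorem mem_ofInput_tag {a : Fin 3} {x : BTree × Fin 3} :
    x ∈ (Interp.ofInput t₀).eval (tagConcept a) ↔ x.2 = a := by
  obtain ⟨t, i⟩ := x
  change ((a : ℕ) = i ∨ ((a : ℕ) = 3 ∧ _) ∨ ((a : ℕ) = 4 ∧ _) ∨ ((a : ℕ) = 5 ∧ _)) ↔ i = a
  constructor
  · rintro (h | ⟨h, -⟩ | ⟨h, -⟩ | ⟨h, -⟩)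
    · exact Fin.ext h.symm
    all_goals omega
  · rintro rfl
    exact .inl rfl

theorem mem_ofInput_leaf {x : BTree × Fin 3} :
    x ∈ (Interp.ofInput t₀).eval leafConcept ↔ x.1 = .leaf := by
  obtain ⟨t, i⟩ := x
  change ((3 : ℕ) = i ∨ _) ↔ t = .leaf
  have : (3 : ℕ) ≠ i := by omega
  simp [this]

theorem mem_ofInput_node {x : BTree × Fin 3} :
    x ∈ (Interp.ofInput t₀).eval nodeConcept ↔ x.1 ≠ .leaf := by
  obtain ⟨t, i⟩ := x
  change ((4 : ℕ) = i ∨ _) ↔ t ≠ .leaf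
  have : (4 : ℕ) ≠ i := by omega
  simp [this]

theorem mem_ofInput_start {x : BTree × Fin 3} :
    x ∈ (Interp.ofInput t₀).eval startConcept ↔ x.1 = t₀ := by
  obtain ⟨t, i⟩ := x
  change ((5 : ℕ) = i ∨ _) ↔ t = t₀
  have : (5 : ℕ) ≠ i := by omega
  simp [this]

theorem ofInput_role {c : Program} {x y : BTree × Fin 3} :
    (Interp.ofInput t₀).roleExt c.roleName x y ↔ Ev c x.1 y.1 :=
  ⟨fun ⟨_, hd, h⟩ => Program.roleName_injective hd ▸ h, fun h => ⟨c, rfl, h⟩⟩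

theorem not_ofInput_role_zero {x y : BTree × Fin 3} : ¬ (Interp.ofInput t₀).roleExt 0 x y :=
  fun ⟨c, hc, _⟩ => c.roleName_ne_zero hc

theorem mem_ofInput_ex {c : Program} {C : Concept} {x : BTree × Fin 3} :
    x ∈ (Interp.ofInput t₀).eval (c.ex C) ↔
      ∃ y : BTree × Fin 3, Ev c x.1 y.1 ∧ y ∈ (Interp.ofInput t₀).eval C := by
  exact exists_congr fun y => and_congr ofInput_role Iff.rfl

/-- Each inclusion mirrors one or more rules of the big-step semantics. Roles ignore tags in the
intended model, so one value `s` serves for every tag of the successor. -/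
theorem exists_ev_of_mem_existential {d : Program} {p : Concept × Concept}
    (hp : p ∈ d.existential) {x : BTree × Fin 3} (hx : x ∈ (Interp.ofInput t₀).eval p.1) :
    ∃ s, Ev d x.1 s ∧ ∀ b, (s, b) ∈ (Interp.ofInput t₀).eval p.2 := by
  obtain ⟨t, i⟩ := x
  cases d <;> simp only [Program.existential, List.mem_cons, List.not_mem_nil, or_false] at hp
  case id =>
    obtain rfl | rfl := hp
    · rw [mem_ofInput_leaf] at hx
      exact ⟨t, .id _, fun _ => mem_ofInput_leaf.2 hx⟩
    · rw [mem_ofInput_node] at hx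
      exact ⟨t, .id _, fun _ => mem_ofInput_node.2 hx⟩
  case leaf =>
    subst hp
    exact ⟨_, .leaf _, fun _ => mem_ofInput_leaf.2 rfl⟩
  case fst =>
    obtain rfl | rfl := hp
    · obtain rfl : t = .leaf := mem_ofInput_leaf.1 hx
      exact ⟨_, .fst_leaf, fun _ => mem_ofInput_leaf.2 rfl⟩
    · cases t
      · exact ⟨_, .fst_leaf, fun _ => trivial⟩
      · exact ⟨_, .fst_node _ _, fun _ => trivial⟩
  case snd =>
    obtain rfl | rfl := hp
    · obtain rfl : t = .leaf := mem_ofInput_leaf.1 hx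
      exact ⟨_, .snd_leaf, fun _ => mem_ofInput_leaf.2 rfl⟩
    · cases t
      · exact ⟨_, .snd_leaf, fun _ => trivial⟩
      · exact ⟨_, .snd_node _ _, fun _ => trivial⟩
  case pair f g =>
    subst hp
    obtain ⟨⟨y, hy, -⟩, ⟨z, hz, -⟩⟩ := hx
    exact ⟨_, .pair (ofInput_role.1 hy) (ofInput_role.1 hz), fun _ => mem_ofInput_node.2 (by simp)⟩
  case comp f g =>
    subst hp
    obtain ⟨y, hy, z, hz, -⟩ := hx
    exact ⟨_, .comp (ofInput_role.1 hy) (ofInput_role.1 hz), fun _ => trivial⟩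
  case ite q f g =>
    obtain rfl | rfl := hp
    · obtain ⟨⟨⟨y, j⟩, hy, hy'⟩, ⟨z, hz, -⟩⟩ := hx
      obtain rfl : y = .leaf := mem_ofInput_leaf.1 hy'
      exact ⟨_, .ite_leaf (ofInput_role.1 hy) (ofInput_role.1 hz), fun _ => trivial⟩
    · obtain ⟨⟨⟨_ | ⟨l, r⟩, j⟩, hy, hy'⟩, ⟨z, hz, -⟩⟩ := hx
      · exact absurd rfl (mem_ofInput_node.1 hy')
      · exact ⟨_, .ite_node (ofInput_role.1 hy) (ofInput_role.1 hz), fun _ => trivial⟩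
  case loop q f =>
    obtain rfl | rfl := hp
    · obtain ⟨⟨y, j⟩, hy, hy'⟩ := hx
      obtain rfl : y = .leaf := mem_ofInput_leaf.1 hy'
      exact ⟨_, .loop_leaf (ofInput_role.1 hy), fun _ => trivial⟩
    · obtain ⟨⟨⟨_ | ⟨l, r⟩, j⟩, hy, hy'⟩, ⟨z, hz, ⟨w, hw, -⟩⟩⟩ := hx
      · exact absurd rfl (mem_ofInput_node.1 hy')
      · exact ⟨_, .loop_node (ofInput_role.1 hy) (ofInput_role.1 hz) (ofInput_role.1 hw), fun _ => trivial⟩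

/-- Each equation is a rule of the big-step semantics, or an inversion of one, read as a statement
on compositions; the condition of the equation supplies the outcome of the test. -/
theorem ev_of_mem_equational {d : Program} {e : Concept × Program × Program × Program}
    (he : e ∈ d.equational) {x : BTree × Fin 3} (hx : x ∈ (Interp.ofInput t₀).eval e.1)
    {s u : BTree} (h₁ : Ev e.2.1 x.1 s) (h₂ : Ev e.2.2.1 s u) : Ev e.2.2.2 x.1 u := by
  obtain ⟨t, i⟩ := x
  cases d <;>
    simp only [Program.equational, List.mem_cons, List.not_mem_nil, or_false] at he
  case fst =>
    obtain rfl | rfl := he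
    · cases h₁; exact h₂
    · cases h₂; exact h₁
  case snd =>
    obtain rfl | rfl := he
    · cases h₁; exact h₂
    · cases h₂; exact h₁
  case pair f g =>
    obtain rfl | rfl := he
    · cases h₁ with | pair h h' => cases h₂; exact h
    · cases h₁ with | pair h h' => cases h₂; exact h'
  case comp f g =>
    subst he
    exact .comp h₁ h₂
  case ite q f g =>
    obtain rfl | rfl := he
    · obtain ⟨⟨y, j⟩, hy, hy'⟩ := hx
      obtain rfl : y = .leaf := mem_ofInput_leaf.1 hy'
      cases h₂
      exact .ite_leaf (ofInput_role.1 hy) h₁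
    · obtain ⟨⟨_ | ⟨l, r⟩, j⟩, hy, hy'⟩ := hx
      · exact absurd rfl (mem_ofInput_node.1 hy')
      · cases h₂
        exact .ite_node (ofInput_role.1 hy) h₁
  case loop q f =>
    obtain rfl | rfl := he
    · obtain ⟨⟨y, j⟩, hy, hy'⟩ := hx
      obtain rfl : y = .leaf := mem_ofInput_leaf.1 hy'
      cases h₁
      cases h₂
      exact .loop_leaf (ofInput_role.1 hy)
    · obtain ⟨⟨_ | ⟨l, r⟩, j⟩, hy, hy'⟩ := hx
      · exact absurd rfl (mem_ofInput_node.1 hy')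
      · exact .loop_node (ofInput_role.1 hy) h₁ h₂

end ofInput

/-- The intended model satisfies all equations, whatever the tags. -/
theorem ofInput_equational (t₀ : BTree) {d : Program} {e : Concept × Program × Program × Program}
    (he : e ∈ d.equational) {a b c : Fin 3} {h : Var → BTree × Fin 3}
    (hh : (Interp.ofInput t₀).IsHom (violation e a b c) h) : h 2 = h 3 := by
  simp only [Interp.IsHom, violation, List.forall_mem_cons, Interp.AtomHolds] at hh
  obtain ⟨⟨h₁, -⟩, -, h₃, h₄, h₅, h₆, h₇, -⟩ := hh
  -- Both end points hold the value of the same program on the same tree, and both carry the tag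
  -- `b`.
  have key := ev_of_mem_equational he h₁ (ofInput_role.1 h₅) (ofInput_role.1 h₆)
  exact Prod.ext (key.unique (ofInput_role.1 h₇))
    ((mem_ofInput_tag.1 h₃).trans (mem_ofInput_tag.1 h₄).symm)

theorem Program.isModel_ofInput {u : Program} {t₀ : BTree} (h : ¬ ∃ t, Ev u t₀ t) :
    u.IsModel (Interp.ofInput t₀) where
  existential d _ p hp a b x hx := by
    obtain ⟨s, hs, hs'⟩ := exists_ev_of_mem_existential hp hx.2
    exact mem_ofInput_ex.2 ⟨(s, b), hs, mem_ofInput_tag.2 rfl, hs' b⟩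
  equational d _ e he a b c _ _ _ h hh := ofInput_equational t₀ he hh
  undefined x hx := by
    obtain ⟨hx, hy⟩ := hx
    obtain ⟨y, hy, -⟩ := mem_ofInput_ex.1 hy
    exact h ⟨y.1, mem_ofInput_start.1 hx ▸ hy⟩
  disjoint _ _ hab _ hx := hab ((mem_ofInput_tag.1 hx.1).symm.trans (mem_ofInput_tag.1 hx.2))
  role_zero _ _ := not_ofInput_role_zero

/-! ### Evaluation in arbitrary models -/

/-- The object `x` has tag `a` and represents the tree. -/
def Interp.Rep (J : Interp) : BTree → Fin 3 → J.Dom → Prop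
  | .leaf, a, x => x ∈ J.eval (tagConcept a) ∧ x ∈ J.eval leafConcept
  | .node l r, a, x => x ∈ J.eval (tagConcept a) ∧ x ∈ J.eval nodeConcept ∧ ∀ b, b ≠ a →
      (∃ y, J.roleExt Program.fst.roleName x y ∧ J.Rep l b y) ∧
      ∃ y, J.roleExt Program.snd.roleName x y ∧ J.Rep r b y

theorem Interp.Rep.tag {J : Interp} {t : BTree} {a : Fin 3} {x : J.Dom} (h : J.Rep t a x) :
    x ∈ J.eval (tagConcept a) := by
  cases t <;> exact h.1

theorem exists_third_tag (a b : Fin 3) : ∃ c, c ≠ a ∧ c ≠ b := by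
  revert a b
  decide

namespace Program.IsModel

variable {u : Program} {J : Interp}

theorem exists_succ (hJ : u.IsModel J) {d : Program} (hd : d ∈ u.support) {C D : Concept}
    (hp : (C, D) ∈ d.existential) {a : Fin 3} (b : Fin 3) {x : J.Dom}
    (ha : x ∈ J.eval (tagConcept a)) (hx : x ∈ J.eval C) :
    ∃ y, J.roleExt d.roleName x y ∧ y ∈ J.eval (tagConcept b) ∧ y ∈ J.eval D :=
  hJ.existential d hd _ hp a b ⟨ha, hx⟩

theorem eq_of_equational (hJ : u.IsModel J) {d : Program} (hd : d ∈ u.support) {C : Concept} {r s v : Program}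
    (he : (C, r, s, v) ∈ d.equational) {a b c : Fin 3} (hab : a ≠ b) (hca : c ≠ a) (hcb : c ≠ b)
    {x y z z' : J.Dom} (hC : x ∈ J.eval C) (hx : x ∈ J.eval (tagConcept a))
    (hy : y ∈ J.eval (tagConcept c)) (hz : z ∈ J.eval (tagConcept b))
    (hz' : z' ∈ J.eval (tagConcept b)) (hr : J.roleExt r.roleName x y)
    (hs : J.roleExt s.roleName y z) (hv : J.roleExt v.roleName x z') : z = z' := by
  have key := hJ.equational d hd _ he a b c hab hca hcb
    (fun n => match n with | 0 => x | 1 => y | 2 => z | _ => z') ?_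
  · exact key
  · simp only [Interp.IsHom, violation, List.forall_mem_cons, Interp.AtomHolds]
    exact ⟨⟨hC, hx⟩, hy, hz, hz', hr, hs, hv, by simp⟩

/-- If every representative of `l` has copies with all other tags, then so have the projections
that lead to `l`. -/
theorem shift_proj (hJ : u.IsModel J) {d : Program} (hd : d ∈ u.support) (h₁ : (.top, .top) ∈ d.existential)
    (h₂ : (.top, d, .id, d) ∈ d.equational) {l : BTree}
    (ih : ∀ {a b : Fin 3} {x : J.Dom}, J.Rep l a x → b ≠ a →
      ∃ y, J.roleExt Program.id.roleName x y ∧ J.Rep l b y)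
    {a c : Fin 3} {x z : J.Dom} (hx : x ∈ J.eval (tagConcept a)) (hca : c ≠ a)
    (hxz : J.roleExt d.roleName x z) (hz : J.Rep l c z) {b : Fin 3} (hb : b ≠ a) :
    ∃ y, J.roleExt d.roleName x y ∧ J.Rep l b y := by
  obtain rfl | hbc := eq_or_ne b c
  · exact ⟨z, hxz, hz⟩
  · obtain ⟨y, hxy, hy, -⟩ := hJ.exists_succ hd h₁ b hx trivial
    obtain ⟨z', hzz', hz'⟩ := ih hz hbc
    obtain rfl := hJ.eq_of_equational hd h₂ hb.symm hca hbc.symm trivial hx hz.tag hz'.tag hy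
      hxz hzz' hxy
    exact ⟨_, hxy, hz'⟩

/-- If `id` maps `x` to `y`, then `y` inherits the projections from `x`. -/
theorem copy_proj (hJ : u.IsModel J) {d : Program} (hd : d ∈ u.support) (h₁ : (.top, .top) ∈ d.existential)
    (h₂ : (.top, .id, d, d) ∈ d.equational) {l : BTree}
    {a b c : Fin 3} {x y : J.Dom} (hx : x ∈ J.eval (tagConcept a)) (hy : y ∈ J.eval (tagConcept b))
    (hba : b ≠ a) (hca : c ≠ a) (hcb : c ≠ b) (hxy : J.roleExt Program.id.roleName x y)
    (h : ∃ z, J.roleExt d.roleName x z ∧ J.Rep l c z) :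
    ∃ z, J.roleExt d.roleName y z ∧ J.Rep l c z := by
  obtain ⟨z, hxz, hz⟩ := h
  obtain ⟨z', hyz', hz', -⟩ := hJ.exists_succ hd h₁ c hy trivial
  obtain rfl := hJ.eq_of_equational hd h₂ hca.symm hba hcb.symm trivial hx hy hz' hz.tag
    hxy hyz' hxz
  exact ⟨_, hyz', hz⟩

/-- Values can be moved between tags. The marker `leaf` or `node` is copied by the inclusions for
`id`, and the subtrees are transferred by the equations for the projections. -/
theorem exists_id (hJ : u.IsModel J) {t : BTree} {a b : Fin 3} {x : J.Dom} (hx : J.Rep t a x) (hb : b ≠ a) :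
    ∃ y, J.roleExt Program.id.roleName x y ∧ J.Rep t b y := by
  induction t generalizing a b x with
  | leaf => exact hJ.exists_succ id_mem_support (by simp [Program.existential]) b hx.1 hx.2
  | node l r ihl ihr =>
    obtain ⟨hxa, hxn, hx⟩ := hx
    obtain ⟨y, hxy, hyb, hyn⟩ :=
      hJ.exists_succ (D := nodeConcept) id_mem_support (by simp [Program.existential]) b hxa hxn
    refine ⟨y, hxy, hyb, hyn, fun c hcb => ?_⟩
    -- The equation for copying needs a successor tag other than `a` and `b`. The remaining case, in
    -- which the successor has tag `a`, is reached from there by shifting, which uses the induction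
    -- hypotheses.
    obtain ⟨c', hc'a, hc'b⟩ := exists_third_tag a b
    obtain ⟨z, hyz, hz⟩ := hJ.copy_proj fst_mem_support (by simp [Program.existential])
      (by simp [Program.equational]) hxa hyb hb hc'a hc'b hxy (hx c' hc'a).1
    obtain ⟨w, hyw, hw⟩ := hJ.copy_proj snd_mem_support (by simp [Program.existential])
      (by simp [Program.equational]) hxa hyb hb hc'a hc'b hxy (hx c' hc'a).2
    exact ⟨hJ.shift_proj fst_mem_support (by simp [Program.existential]) (by simp [Program.equational])
        ihl hyb hc'b hyz hz hcb,
      hJ.shift_proj snd_mem_support (by simp [Program.existential]) (by simp [Program.equational])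
        ihr hyb hc'b hyw hw hcb⟩

/-- A node is represented as soon as its subtrees are, for one tag each. -/
theorem rep_node (hJ : u.IsModel J) {l r : BTree} {a b c : Fin 3} {x y z : J.Dom} (hx : x ∈ J.eval (tagConcept a))
    (hxn : x ∈ J.eval nodeConcept) (hb : b ≠ a) (hxy : J.roleExt Program.fst.roleName x y)
    (hy : J.Rep l b y) (hc : c ≠ a) (hxz : J.roleExt Program.snd.roleName x z)
    (hz : J.Rep r c z) : J.Rep (.node l r) a x :=
  ⟨hx, hxn, fun _ hd =>
    ⟨hJ.shift_proj fst_mem_support (by simp [Program.existential]) (by simp [Program.equational])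
        hJ.exists_id hx hb hxy hy hd,
      hJ.shift_proj snd_mem_support (by simp [Program.existential]) (by simp [Program.equational])
        hJ.exists_id hx hc hxz hz hd⟩⟩

/-- Transfer along an equation between roles. -/
theorem exists_of_equational (hJ : u.IsModel J) {d : Program} (hd : d ∈ u.support) {C : Concept} {r s v : Program}
    (he : (C, r, s, v) ∈ d.equational) {a b c : Fin 3} (hab : a ≠ b) (hca : c ≠ a) (hcb : c ≠ b)
    {x y z : J.Dom} {t : BTree} (hC : x ∈ J.eval C) (hx : x ∈ J.eval (tagConcept a))
    (hy : y ∈ J.eval (tagConcept c)) (hz : J.Rep t b z) (hr : J.roleExt r.roleName x y)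
    (hs : J.roleExt s.roleName y z)
    (hv : ∃ z', J.roleExt v.roleName x z' ∧ z' ∈ J.eval (tagConcept b) ∧ z' ∈ J.eval .top) :
    ∃ z', J.roleExt v.roleName x z' ∧ J.Rep t b z' := by
  obtain ⟨z', hv, hz', -⟩ := hv
  obtain rfl := hJ.eq_of_equational hd he hab hca hcb hC hx hy hz.tag hz' hr hs hv
  exact ⟨_, hv, hz⟩

/-- Induction on the run. Intermediate values are placed at the third tag `c'`; then an inclusion
supplies some successor along the role of `c`, and an equation forces it to be the right object. -/
theorem exists_rep_of_ev (hJ : u.IsModel J) {c : Program} {t s : BTree} (h : Ev c t s)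
    (hc : ∀ d ∈ c.subs, d ∈ u.support) {a b : Fin 3} {x : J.Dom} (hx : J.Rep t a x) (hb : b ≠ a) :
    ∃ y, J.roleExt c.roleName x y ∧ J.Rep s b y := by
  have hself := hc _ c.self_mem_subs
  induction h generalizing a b x with
  | id => exact hJ.exists_id hx hb
  | leaf => exact hJ.exists_succ (C := .top) hself (by simp [Program.existential]) b hx.tag (Set.mem_univ _)
  | fst_leaf | snd_leaf => exact hJ.exists_succ hself (by simp [Program.existential]) b hx.1 hx.2
  | fst_node => exact (hx.2.2 b hb).1
  | snd_node => exact (hx.2.2 b hb).2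
  | @pair f g t l r _ _ ihf ihg =>
    have hf : ∀ d ∈ f.subs, d ∈ u.support := fun d hd => hc d (by simp [subs, hd])
    have hg : ∀ d ∈ g.subs, d ∈ u.support := fun d hd => hc d (by simp [subs, hd])
    obtain ⟨c', hc'a, hc'b⟩ := exists_third_tag a b
    obtain ⟨y, hxy, hy⟩ := ihf hf hx hc'a (hf _ f.self_mem_subs)
    obtain ⟨z, hxz, hz⟩ := ihg hg hx hc'a (hg _ g.self_mem_subs)
    obtain ⟨w, hxw, hwb, hwn⟩ := hJ.exists_succ (C := .conj (f.ex .top) (g.ex .top))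
      (D := nodeConcept) hself (by simp [Program.existential]) b hx.tag
      ⟨⟨y, hxy, trivial⟩, ⟨z, hxz, trivial⟩⟩
    -- The projections of the new pair `w` exist for lack of any condition, and the equations
    -- identify them with the values of `f` and `g`.
    obtain ⟨y', hwy', hy', -⟩ :=
      hJ.exists_succ (C := .top) (D := .top) fst_mem_support (by simp [Program.existential]) c' hwb (Set.mem_univ _)
    obtain ⟨z', hwz', hz', -⟩ :=
      hJ.exists_succ (C := .top) (D := .top) snd_mem_support (by simp [Program.existential]) c' hwb (Set.mem_univ _)
    obtain rfl := hJ.eq_of_equational hself (C := .top) (r := .pair f g) (s := .fst) (v := f)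
      (by simp [Program.equational]) hc'a.symm hb hc'b.symm trivial hx.tag hwb hy' hy.tag hxw hwy' hxy
    obtain rfl := hJ.eq_of_equational hself (C := .top) (r := .pair f g) (s := .snd) (v := g)
      (by simp [Program.equational]) hc'a.symm hb hc'b.symm trivial hx.tag hwb hz' hz.tag hxw hwz' hxz
    exact ⟨w, hxw, hJ.rep_node hwb hwn hc'b hwy' hy hc'b hwz' hz⟩
  | @comp f g t s v _ _ ihg ihf =>
    have hf : ∀ d ∈ f.subs, d ∈ u.support := fun d hd => hc d (by simp [subs, hd])
    have hg : ∀ d ∈ g.subs, d ∈ u.support := fun d hd => hc d (by simp [subs, hd])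
    obtain ⟨c', hc'a, hc'b⟩ := exists_third_tag a b
    obtain ⟨y, hxy, hy⟩ := ihg hg hx hc'a (hg _ g.self_mem_subs)
    obtain ⟨z, hyz, hz⟩ := ihf hf hy hc'b.symm (hf _ f.self_mem_subs)
    exact hJ.exists_of_equational hself (C := .top) (r := g) (s := f) (by simp [Program.equational])
      hb.symm hc'a hc'b trivial hx.tag hy.tag hz hxy hyz
      (hJ.exists_succ hself (C := g.ex (f.ex .top)) (by simp [Program.existential]) b hx.tag
        ⟨y, hxy, z, hyz, trivial⟩)
  | @ite_leaf p f g t s _ _ ihp ihf =>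
    have hp : ∀ d ∈ p.subs, d ∈ u.support := fun d hd => hc d (by simp [subs, hd])
    have hf : ∀ d ∈ f.subs, d ∈ u.support := fun d hd => hc d (by simp [subs, hd])
    obtain ⟨c', hc'a, hc'b⟩ := exists_third_tag a b
    obtain ⟨w, hxw, hw⟩ := ihp hp hx hb (hp _ p.self_mem_subs)
    obtain ⟨y, hxy, hy⟩ := ihf hf hx hc'a (hf _ f.self_mem_subs)
    -- Equations have two factors on the left, so `f` is padded with `id`, which also brings the
    -- value to the tag `b`.
    obtain ⟨z, hyz, hz⟩ := hJ.exists_id hy hc'b.symm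
    have hxC : x ∈ J.eval (p.ex leafConcept) := ⟨w, hxw, hw.2⟩
    exact hJ.exists_of_equational hself (C := p.ex leafConcept) (r := f) (s := .id)
      (by simp [Program.equational]) hb.symm hc'a hc'b hxC hx.tag hy.tag hz hxy hyz
      (hJ.exists_succ hself (C := .conj (p.ex leafConcept) (f.ex .top)) (by simp [Program.existential])
        b hx.tag ⟨hxC, y, hxy, trivial⟩)
  | @ite_node p f g t l r s _ _ ihp ihg =>
    have hp : ∀ d ∈ p.subs, d ∈ u.support := fun d hd => hc d (by simp [subs, hd])
    have hg : ∀ d ∈ g.subs, d ∈ u.support := fun d hd => hc d (by simp [subs, hd])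
    obtain ⟨c', hc'a, hc'b⟩ := exists_third_tag a b
    obtain ⟨w, hxw, hw⟩ := ihp hp hx hb (hp _ p.self_mem_subs)
    obtain ⟨y, hxy, hy⟩ := ihg hg hx hc'a (hg _ g.self_mem_subs)
    obtain ⟨z, hyz, hz⟩ := hJ.exists_id hy hc'b.symm
    have hxC : x ∈ J.eval (p.ex nodeConcept) := ⟨w, hxw, hw.2.1⟩
    exact hJ.exists_of_equational hself (C := p.ex nodeConcept) (r := g) (s := .id)
      (by simp [Program.equational]) hb.symm hc'a hc'b hxC hx.tag hy.tag hz hxy hyz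
      (hJ.exists_succ hself (C := .conj (p.ex nodeConcept) (g.ex .top)) (by simp [Program.existential])
        b hx.tag ⟨hxC, y, hxy, trivial⟩)
  | @loop_leaf p f t _ ihp =>
    have hp : ∀ d ∈ p.subs, d ∈ u.support := fun d hd => hc d (by simp [subs, hd])
    obtain ⟨c', hc'a, hc'b⟩ := exists_third_tag a b
    obtain ⟨w, hxw, hw⟩ := ihp hp hx hb (hp _ p.self_mem_subs)
    obtain ⟨y, hxy, hy⟩ := hJ.exists_id hx hc'a
    obtain ⟨z, hyz, hz⟩ := hJ.exists_id hy hc'b.symm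
    have hxC : x ∈ J.eval (p.ex leafConcept) := ⟨w, hxw, hw.2⟩
    exact hJ.exists_of_equational hself (C := p.ex leafConcept) (r := .id) (s := .id)
      (by simp [Program.equational]) hb.symm hc'a hc'b hxC hx.tag hy.tag hz hxy hyz
      (hJ.exists_succ hself (C := p.ex leafConcept) (by simp [Program.existential]) b hx.tag hxC)
  | @loop_node p f t l r s v _ _ _ ihp ihf ihl =>
    have hp : ∀ d ∈ p.subs, d ∈ u.support := fun d hd => hc d (by simp [subs, hd])
    have hf : ∀ d ∈ f.subs, d ∈ u.support := fun d hd => hc d (by simp [subs, hd])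
    obtain ⟨c', hc'a, hc'b⟩ := exists_third_tag a b
    obtain ⟨w, hxw, hw⟩ := ihp hp hx hb (hp _ p.self_mem_subs)
    obtain ⟨y, hxy, hy⟩ := ihf hf hx hc'a (hf _ f.self_mem_subs)
    -- The induction is on the run, so the remaining iterations of the same loop are covered.
    obtain ⟨z, hyz, hz⟩ := ihl hc hy hc'b.symm hself
    have hxC : x ∈ J.eval (p.ex nodeConcept) := ⟨w, hxw, hw.2.1⟩
    exact hJ.exists_of_equational hself (C := p.ex nodeConcept) (r := f) (s := .loop p f)
      (by simp [Program.equational]) hb.symm hc'a hc'b hxC hx.tag hy.tag hz hxy hyz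
      (hJ.exists_succ hself
        (C := .conj (p.ex nodeConcept) (f.ex (Program.ex (.loop p f) .top)))
        (by simp [Program.existential]) b hx.tag ⟨hxC, y, hxy, z, hyz, trivial⟩)

end Program.IsModel

/-! ### Input concepts -/

/-- A concept that describes the objects that represent the numeral `m`, with tag `m % 2`. -/
def numConcept : ℕ → Concept
  | 0 => .conj (.name 0) leafConcept
  | m + 1 => .conj (.name ((m + 1) % 2)) (.conj nodeConcept
      (.conj (Program.ex .fst (.conj (.name 2) leafConcept)) (Program.ex .snd (numConcept m))))

/-- A concept that describes the objects that represent the input `[m]`. -/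
def inputConcept (m : ℕ) : Concept :=
  .conj startConcept (.conj (.name 2) (.conj nodeConcept
    (.conj (Program.ex .snd (.conj (.name 0) leafConcept)) (Program.ex .fst (numConcept m)))))

theorem mem_ofInput_numConcept {t₀ : BTree} (m : ℕ) :
    (num m, ⟨m % 2, by omega⟩) ∈ (Interp.ofInput t₀).eval (numConcept m) := by
  induction m with
  | zero => exact ⟨mem_ofInput_tag (a := 0).2 rfl, mem_ofInput_leaf.2 rfl⟩
  | succ m ih =>
    refine ⟨mem_ofInput_tag (a := ⟨(m + 1) % 2, by omega⟩).2 rfl, mem_ofInput_node.2 (by simp [num]),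
      mem_ofInput_ex.2 ⟨((.leaf, 2) : BTree × Fin 3), Ev.fst_node _ _, mem_ofInput_tag (a := 2).2 rfl,
        mem_ofInput_leaf.2 rfl⟩, mem_ofInput_ex.2 ⟨(num m, _), Ev.snd_node .leaf (num m), ih⟩⟩

theorem ofInput_inputConcept_nonempty (m : ℕ) :
    ((Interp.ofInput (list [m])).eval (inputConcept m)).Nonempty :=
  ⟨(list [m], 2), mem_ofInput_start.2 rfl, mem_ofInput_tag (a := 2).2 rfl,
    mem_ofInput_node.2 (by simp [list]),
    mem_ofInput_ex.2 ⟨((.leaf, 0) : BTree × Fin 3), Ev.snd_node _ _, mem_ofInput_tag (a := 0).2 rfl,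
      mem_ofInput_leaf.2 rfl⟩,
    mem_ofInput_ex.2 ⟨(num m, _), Ev.fst_node (num m) .leaf, mem_ofInput_numConcept m⟩⟩

/-- Consecutive numerals alternate between the tags `0` and `1`, and the heads have tag `2`, so a
node never shares its tag with a child, as `rep_node` requires. -/
theorem Program.IsModel.rep_num {u : Program} {J : Interp} (hJ : u.IsModel J) {m : ℕ} {x : J.Dom}
    (hx : x ∈ J.eval (numConcept m)) : J.Rep (num m) ⟨m % 2, by omega⟩ x := by
  induction m generalizing x with
  | zero => exact hx
  | succ m ih =>
    obtain ⟨hx₁, hx₂, ⟨y, hxy, hy⟩, ⟨z, hxz, hz⟩⟩ := hx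
    refine hJ.rep_node (b := 2) (c := ⟨m % 2, by omega⟩) hx₁ hx₂ ?_ hxy hy ?_ hxz (ih hz)
    · simp only [ne_eq, Fin.ext_iff, Fin.val_two]
      omega
    · simp only [ne_eq, Fin.ext_iff]
      omega

/-- A terminating run would produce a successor along the role of `u` at the start object, which the
axioms forbid. -/
theorem Program.IsModel.not_ev {u : Program} {J : Interp} (hJ : u.IsModel J) {m : ℕ}
    (h : (J.eval (inputConcept m)).Nonempty) : ¬ ∃ t, Ev u (list [m]) t := by
  rintro ⟨t, ht⟩
  obtain ⟨x, hx₁, hx₂, hx₃, ⟨y, hxy, hy⟩, ⟨z, hxz, hz⟩⟩ := h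
  have hx : J.Rep (list [m]) 2 x :=
    hJ.rep_node (a := 2) (b := ⟨m % 2, by omega⟩) (c := 0) hx₂ hx₃
      (by simp only [ne_eq, Fin.ext_iff, Fin.val_two]; omega) hxz (hJ.rep_num hz) (by decide)
      hxy hy
  obtain ⟨w, hxw, -⟩ := hJ.exists_rep_of_ev ht (fun d hd => by simp [support, hd]) hx
    (b := 0) (by decide)
  exact hJ.undefined ⟨hx₁, w, hxw, trivial⟩

/-- Undefinedness of a program on `[m]` is a satisfiability problem. -/
theorem Program.exists_isModel_iff (u : Program) (m : ℕ) :
    (∃ J, u.IsModel J ∧ (J.eval (inputConcept m)).Nonempty) ↔ ¬ ∃ t, Ev u (list [m]) t :=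
  ⟨fun ⟨_, hJ, h⟩ => hJ.not_ev h, fun h =>
    ⟨_, isModel_ofInput h, ofInput_inputConcept_nonempty m⟩⟩

/-! ### Ontologies -/

/-- Triples of distinct tags. -/
def tagTriples : List (Fin 3 × Fin 3 × Fin 3) :=
  [(0, 1, 2), (0, 2, 1), (1, 0, 2), (1, 2, 0), (2, 0, 1), (2, 1, 0)]

theorem mem_tagTriples : ∀ a b c : Fin 3,
    (a, b, c) ∈ tagTriples ↔ a ≠ b ∧ c ≠ a ∧ c ≠ b := by
  decide

/-- The concept inclusions for the program, at level `0`. -/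
def Program.inclusions (u : Program) : List (Concept × Concept) :=
  (.conj startConcept (u.ex .top), botConcept) ::
  tagTriples.map (fun t => (.conj (tagConcept t.1) (tagConcept t.2.1), botConcept)) ++
  u.support.flatMap fun d => d.existential.flatMap fun p =>
    (List.finRange 3).flatMap fun a => (List.finRange 3).map fun b =>
      (.conj (tagConcept a) p.1, d.ex (.conj (tagConcept b) p.2))

/-- The queries for the violations of the equations of the program. -/
def Program.violations (u : Program) : List (List Atom) :=
  u.support.flatMap fun d => d.equational.flatMap fun e =>
    tagTriples.map fun t => violation e t.1 t.2.1 t.2.2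

theorem Program.mem_inclusions {u : Program} {p : Concept × Concept} :
    p ∈ u.inclusions ↔ p = (.conj startConcept (u.ex .top), botConcept) ∨
      (∃ a b : Fin 3, a ≠ b ∧ p = (.conj (tagConcept a) (tagConcept b), botConcept)) ∨
      ∃ d ∈ u.support, ∃ q ∈ d.existential, ∃ a b : Fin 3,
        p = (.conj (tagConcept a) q.1, d.ex (.conj (tagConcept b) q.2)) := by
  simp only [inclusions, List.cons_append, List.mem_cons, List.mem_append, List.mem_map,
    List.mem_flatMap, List.mem_finRange, true_and, Prod.exists]
  refine or_congr_right (or_congr ⟨?_, ?_⟩ ?_)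
  · rintro ⟨a, b, c, h, rfl⟩
    exact ⟨a, b, ((mem_tagTriples a b c).1 h).1, rfl⟩
  · rintro ⟨a, b, h, rfl⟩
    -- Pairs of distinct tags are listed through their completions to triples.
    obtain ⟨c, hca, hcb⟩ := exists_third_tag a b
    exact ⟨a, b, c, (mem_tagTriples a b c).2 ⟨h, hca, hcb⟩, rfl⟩
  · simp only [eq_comm]

theorem Program.mem_violations {u : Program} {q : List Atom} :
    q ∈ u.violations ↔ ∃ d ∈ u.support, ∃ e ∈ d.equational, ∃ a b c : Fin 3,
      (a ≠ b ∧ c ≠ a ∧ c ≠ b) ∧ q = violation e a b c := by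
  simp only [violations, List.mem_flatMap, List.mem_map, Prod.exists, mem_tagTriples]
  simp only [eq_comm]

/-- Passes from the axioms to the finite lists in the ontology; once role `0` is empty, `botConcept`
is a genuine falsum. -/
theorem Program.isModel_iff {u : Program} {J : Interp} :
    u.IsModel J ↔ (∀ x y, ¬ J.roleExt 0 x y) ∧ (∀ p ∈ u.inclusions, J.eval p.1 ⊆ J.eval p.2) ∧
      ∀ q ∈ u.violations, ∀ h, J.IsHom q h → h 2 = h 3 := by
  constructor
  · refine fun hJ => ⟨hJ.role_zero, fun p hp => ?_, fun q hq h hh => ?_⟩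
    · obtain rfl | ⟨a, b, hab, rfl⟩ | ⟨d, hd, q, hq, a, b, rfl⟩ := mem_inclusions.1 hp
      · exact fun _ hx => (hJ.undefined hx).elim
      · exact fun _ hx => (hJ.disjoint a b hab hx).elim
      · exact hJ.existential d hd q hq a b
    · obtain ⟨d, hd, e, he, a, b, c, ⟨hab, hca, hcb⟩, rfl⟩ := mem_violations.1 hq
      exact hJ.equational d hd e he a b c hab hca hcb h hh
  · rintro ⟨h₀, h₁, h₂⟩
    have hbot : J.eval botConcept ⊆ ∅ := fun _ ⟨_, h, _⟩ => h₀ _ _ h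
    exact {
      existential := fun d hd p hp a b =>
        h₁ (_, _) (mem_inclusions.2 (.inr (.inr ⟨d, hd, p, hp, a, b, rfl⟩)))
      equational := fun d hd e he a b c hab hca hcb =>
        h₂ _ (mem_violations.2 ⟨d, hd, e, he, a, b, c, ⟨hab, hca, hcb⟩, rfl⟩)
      undefined := (h₁ (_, _) (mem_inclusions.2 (.inl rfl))).trans hbot
      disjoint := fun a b hab =>
        (h₁ (_, _) (mem_inclusions.2 (.inr (.inl ⟨a, b, hab, rfl⟩)))).trans hbot
      role_zero := h₀ }

/-- Concept abstractions that rule out violations, if role `0` is empty at level `1`. -/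
def Program.conceptAbstractions (u : Program) : Ontology :=
  .ca 1 botConcept 0 [0] [.concept botConcept 0] ::
    u.violations.map fun q => .ca 1 botConcept 0 [0, 1, 2, 3] q

/-- Role abstractions that rule out violations, if role `0` is empty at level `1`. -/
def Program.roleAbstractions (u : Program) : Ontology :=
  .ra 1 (.name 0) 0 [0] [1] [.role 0 0 1] ::
    u.violations.map fun q => .ra 1 (.name 0) 0 [2, 3] [0, 1] q

/-- An `ALC`-ontology that makes role `0` empty at level `1`. -/
def emptyRoleALC : Ontology := [.ci 1 .top (.neg botConcept)]

/-- Role refinements that make role `0` empty at level `1`, since they require ensembles of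
different lengths. -/
def emptyRoleEL : Ontology :=
  [.rr 0 [0] [1] [.concept .top 0, .concept .top 1] 1 .top (.name 0) .top,
    .rr 0 [0, 1] [2] [.concept .top 0, .concept .top 1, .concept .top 2] 1 .top (.name 0) .top]

/-- The concept inclusions of the program at level `0`, together with further statements. -/
def Program.ontology (u : Program) (O : Ontology) : Ontology :=
  u.inclusions.map (fun p => .ci 0 p.1 p.2) ++ O

/-! ### What the refinement and abstraction statements enforce -/

/-- The statements enforce that role `0` is empty at level `1`. -/
def EmptiesRole (E : Ontology) : Prop :=
  ∀ I : AInterp, (∀ s ∈ E, I.Satisfies s) →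
    ∀ (hK : 1 ∈ I.levels) (x y), ¬ (I.interp ⟨1, hK⟩).roleExt 0 x y

theorem emptiesRole_ALC : EmptiesRole emptyRoleALC := by
  intro I hI hK x y hxy
  obtain ⟨_, h⟩ := hI (.ci 1 .top (.neg botConcept)) (by simp [emptyRoleALC])
  exact h (Set.mem_univ x) ⟨y, hxy, trivial⟩

theorem emptiesRole_EL : EmptiesRole emptyRoleEL := by
  intro I hI hK x y hxy
  obtain ⟨_, _, _, h₁⟩ := hI (.rr 0 [0] [1] [.concept .top 0, .concept .top 1] 1 .top
    (.name 0) .top) (by simp [emptyRoleEL])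
  obtain ⟨_, _, _, h₂⟩ := hI (.rr 0 [0, 1] [2] [.concept .top 0, .concept .top 1,
    .concept .top 2] 1 .top (.name 0) .top) (by simp [emptyRoleEL])
  obtain ⟨e, ⟨f, -, he, -⟩, he', -⟩ := h₁ x y trivial hxy trivial
  obtain ⟨e₂, ⟨f₂, -, he₂, -⟩, he₂', -⟩ := h₂ x y trivial hxy trivial
  -- The ensemble of `x` would have length one and length two.
  have := Option.some.inj (he'.symm.trans he₂')
  rw [← he, ← he₂] at this
  simp at this

/-- If role `0` is empty at level `1`, then the statements enforce that it is empty at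
level `0`, and that violations with distinct tags do not occur at level `0`. -/
def ForbidsViolations (u : Program) (F : Ontology) : Prop :=
  ∀ I : AInterp, (∀ s ∈ F, I.Satisfies s) →
    (∀ (hK : 1 ∈ I.levels) (x y), ¬ (I.interp ⟨1, hK⟩).roleExt 0 x y) →
    ∀ hL : 0 ∈ I.levels, (∀ x y, ¬ (I.interp ⟨0, hL⟩).roleExt 0 x y) ∧
      ∀ q ∈ u.violations, ∀ h, (I.interp ⟨0, hL⟩).IsHom q h →
        h 0 ≠ h 1 → h 0 ≠ h 2 → h 0 ≠ h 3 → h 1 ≠ h 2 → h 1 ≠ h 3 → h 2 = h 3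

theorem forbidsViolations_ca (u : Program) : ForbidsViolations u u.conceptAbstractions := by
  intro I hI h₀ hL
  constructor
  · intro x y hxy
    obtain ⟨_, hK, -, h⟩ := hI _ (List.mem_cons_self ..)
    -- A tuple of length one has no repetition, so the first statement applies to every object and
    -- carries emptiness from level `1` down to level `0`.
    obtain ⟨d, ⟨d', hd, -⟩, -⟩ := h [x] ⟨fun _ => x, by
      simpa [Interp.IsHom, Interp.AtomHolds] using ⟨y, hxy, trivial⟩, rfl⟩ (by simp)
    exact h₀ hK _ _ hd
  · intro q hq h hh h01 h02 h03 h12 h13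
    by_contra h23
    obtain ⟨_, hK, -, H⟩ := hI _ (List.mem_cons_of_mem _ (List.mem_map_of_mem hq))
    obtain ⟨d, ⟨d', hd, -⟩, -⟩ := H _ ⟨h, hh, rfl⟩
      (by simp [h01, h02, h03, h12, h13, h23])
    exact h₀ hK _ _ hd

/-- For role abstractions only each of the two tuples must be repetition-free. Variables `2` and `3`
share a tuple, so their being distinct matters, while `0` and `1` form the other. Singletons cover
the atom for role `0`, even on loops. -/
theorem forbidsViolations_ra (u : Program) : ForbidsViolations u u.roleAbstractions := by
  intro I hI h₀ hL
  constructor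
  · intro x y hxy
    obtain ⟨_, hK, -, h⟩ := hI _ (List.mem_cons_self ..)
    obtain ⟨d, d', hd, -⟩ := h ([x], [y]) ⟨fun n => if n = 0 then x else y, by
      simpa [Interp.IsHom, Interp.AtomHolds] using hxy, by simp, by simp⟩ (by simp) (by simp)
    exact h₀ hK _ _ hd
  · intro q hq h hh h01 _ _ _ _
    by_contra h23
    obtain ⟨_, hK, -, H⟩ := hI _ (List.mem_cons_of_mem _ (List.mem_map_of_mem hq))
    obtain ⟨d, d', hd, -⟩ := H ([h 2, h 3], [h 0, h 1]) ⟨h, hh, rfl, rfl⟩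
      (by simp [h23]) (by simp [h01])
    exact h₀ hK _ _ hd

/-! ### The A-interpretation of a model -/

/-- An interpretation with one object and empty extensions. -/
def Interp.point : Interp where
  Dom := Unit
  nonempty := ⟨()⟩
  conceptExt _ := ∅
  roleExt _ _ _ := False

/-- Level `0` is interpreted by `J`; level `1` is above it, and nothing is refined. -/
def Interp.twoLevels (J : Interp) : AInterp where
  levels := {n | n < 2}
  prec L K := L.1 = 0 ∧ K.1 = 1
  tree := by
    refine ⟨⟨1, by simp⟩, ?_, ?_, ?_⟩
    · rintro ⟨n, hn⟩
      obtain rfl | rfl : n = 0 ∨ n = 1 :=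
        Nat.le_one_iff_eq_zero_or_eq_one.1 (Nat.lt_succ_iff.1 hn)
      · exact .single ⟨rfl, rfl⟩
      · exact .refl
    · rintro u ⟨h, -⟩
      simp at h
    · rintro u w v ⟨-, hu⟩ ⟨-, hw⟩
      exact Subtype.ext (hu.trans hw.symm)
  interp L := match L.1 with
    | 0 => J
    | _ + 1 => .point
  ref _ _ _ := none
  prec_of_ref h := by simp at h
  ref_ne_nil h := by simp at h
  ref_unique _ _ _ _ _ _ _ h := by simp at h

theorem Interp.twoLevels_repetitionFree (J : Interp) : J.twoLevels.RepetitionFree := by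
  intro K L d e h
  simp [twoLevels] at h

theorem Interp.zero_mem_twoLevels (J : Interp) : 0 ∈ J.twoLevels.levels := by
  simp [twoLevels]

theorem Interp.one_mem_twoLevels (J : Interp) : 1 ∈ J.twoLevels.levels := by
  simp [twoLevels]

theorem satisfies_emptyRoleALC (J : Interp) : ∀ s ∈ emptyRoleALC, J.twoLevels.Satisfies s := by
  simp only [emptyRoleALC, List.mem_singleton, forall_eq]
  exact ⟨J.one_mem_twoLevels, fun _ _ ⟨_, h, _⟩ => h⟩

theorem satisfies_emptyRoleEL (J : Interp) : ∀ s ∈ emptyRoleEL, J.twoLevels.Satisfies s := by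
  simp only [emptyRoleEL, List.forall_mem_cons]
  exact ⟨⟨J.zero_mem_twoLevels, J.one_mem_twoLevels, ⟨rfl, rfl⟩, fun _ _ _ h => h.elim⟩,
    ⟨J.zero_mem_twoLevels, J.one_mem_twoLevels, ⟨rfl, rfl⟩, fun _ _ _ h => h.elim⟩, by simp⟩

/-- Nothing is refined, so no abstraction may apply: every match of a violation query has equal
values at `2` and `3`, hence repeats an object. -/
theorem Program.IsModel.satisfies_conceptAbstractions {u : Program} {J : Interp}
    (hJ : u.IsModel J) : ∀ s ∈ u.conceptAbstractions, J.twoLevels.Satisfies s := by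
  obtain ⟨h₀, -, h₂⟩ := isModel_iff.1 hJ
  simp only [conceptAbstractions, List.forall_mem_cons, List.forall_mem_map]
  refine ⟨⟨J.zero_mem_twoLevels, J.one_mem_twoLevels, ⟨rfl, rfl⟩, ?_⟩, fun q hq =>
    ⟨J.zero_mem_twoLevels, J.one_mem_twoLevels, ⟨rfl, rfl⟩, ?_⟩⟩
  · rintro _ ⟨h, hh, rfl⟩ _
    obtain ⟨y, hy, -⟩ := hh _ (List.mem_cons_self ..)
    exact (h₀ _ _ hy).elim
  · rintro _ ⟨h, hh, rfl⟩ hn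
    have key : h 2 = h 3 := h₂ q hq h hh
    simp [key] at hn

theorem Program.IsModel.satisfies_roleAbstractions {u : Program} {J : Interp}
    (hJ : u.IsModel J) : ∀ s ∈ u.roleAbstractions, J.twoLevels.Satisfies s := by
  obtain ⟨h₀, -, h₂⟩ := isModel_iff.1 hJ
  simp only [roleAbstractions, List.forall_mem_cons, List.forall_mem_map]
  refine ⟨⟨J.zero_mem_twoLevels, J.one_mem_twoLevels, ⟨rfl, rfl⟩, ?_⟩, fun q hq =>
    ⟨J.zero_mem_twoLevels, J.one_mem_twoLevels, ⟨rfl, rfl⟩, ?_⟩⟩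
  · rintro _ ⟨h, hh, -⟩ _
    exact (h₀ _ _ (hh _ (List.mem_cons_self ..))).elim
  · rintro ⟨_, _⟩ ⟨h, hh, rfl, rfl⟩ hn
    have key : h 2 = h 3 := h₂ q hq h hh
    simp [key] at hn

/-! ### Correctness of the reduction -/

/-- The satisfiability problem for the program `u` and the input `m`. -/
def Program.toInstance (u : Program) (O : Ontology) (m : ℕ) : Instance :=
  ⟨u.ontology O, inputConcept m, 0⟩

theorem Program.satisfiable_iff {u : Program} {E F : Ontology} (hE : EmptiesRole E)
    (hF : ForbidsViolations u F)
    (h : ∀ J, u.IsModel J → ∀ s ∈ E ++ F, J.twoLevels.Satisfies s) (m : ℕ) :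
    (u.toInstance (E ++ F) m).Satisfiable ↔ ¬ ∃ t, Ev u (list [m]) t := by
  rw [← exists_isModel_iff]
  constructor
  · rintro ⟨I, -, hI, hL, hne⟩
    refine ⟨I.interp ⟨0, hL⟩, ?_, hne⟩
    simp only [toInstance, ontology, List.forall_mem_append, List.forall_mem_map] at hI
    obtain ⟨h₁, h₂, h₃⟩ := hI
    obtain ⟨h₀, h₄⟩ := hF I h₃ (hE I h₂) hL
    have hincl : ∀ p ∈ u.inclusions, (I.interp ⟨0, hL⟩).eval p.1 ⊆
        (I.interp ⟨0, hL⟩).eval p.2 := fun p hp => (h₁ p hp).2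
    -- Disjointness of tags separates all variables of a violation except `2` and `3`.
    have hne : ∀ {a b : Fin 3} {x y : (I.interp ⟨0, hL⟩).Dom}, a ≠ b →
        x ∈ (I.interp ⟨0, hL⟩).eval (tagConcept a) → y ∈ (I.interp ⟨0, hL⟩).eval (tagConcept b) →
        x ≠ y := by
      rintro a b x _ hab hx hy rfl
      obtain ⟨z, hz, -⟩ := hincl (_, _) (mem_inclusions.2 (.inr (.inl ⟨a, b, hab, rfl⟩))) ⟨hx, hy⟩
      exact h₀ _ _ hz
    refine isModel_iff.2 ⟨h₀, hincl, fun q hq f hf => ?_⟩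
    obtain ⟨d, hd, e, he, a, b, c, ⟨hab, hca, hcb⟩, rfl⟩ := mem_violations.1 hq
    have hf' := hf
    simp only [Interp.IsHom, violation, List.forall_mem_cons, Interp.AtomHolds] at hf'
    obtain ⟨⟨-, k₀⟩, k₁, k₂, k₃, -⟩ := hf'
    exact h₄ _ hq f hf (hne hca.symm k₀ k₁) (hne hab k₀ k₂) (hne hab k₀ k₃) (hne hcb k₁ k₂)
      (hne hcb k₁ k₃)
  · rintro ⟨J, hJ, hne⟩
    refine ⟨J.twoLevels, J.twoLevels_repetitionFree, fun s hs => ?_, J.zero_mem_twoLevels, hne⟩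
    obtain hs | hs := List.mem_append.1 hs
    · obtain ⟨p, hp, rfl⟩ := List.mem_map.1 hs
      exact ⟨J.zero_mem_twoLevels, (isModel_iff.1 hJ).2.1 p hp⟩
    · exact h J hJ s hs

/-! ### Fragments -/

theorem Concept.IsEL.isALC {C : Concept} (h : C.IsEL) : C.IsALC := by
  induction C with
  | top | name => trivial
  | neg | disj | all => exact h.elim
  | conj _ _ ih₁ ih₂ => exact ⟨ih₁ h.1, ih₂ h.2⟩
  | ex _ _ ih => exact ⟨h.1, ih h.2⟩

theorem Program.isEL_of_mem_existential {d : Program} {p : Concept × Concept}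
    (hp : p ∈ d.existential) : p.1.IsEL ∧ p.2.IsEL := by
  cases d <;> simp only [existential, List.mem_cons, List.not_mem_nil, or_false] at hp <;>
    obtain rfl | rfl := hp <;> simp [Concept.IsEL, Role.IsName]

theorem Program.isEL_of_mem_equational {d : Program} {e : Concept × Program × Program × Program}
    (he : e ∈ d.equational) : e.1.IsEL := by
  cases d <;> simp only [equational, List.mem_cons, List.not_mem_nil, or_false] at he <;>
    obtain rfl | rfl := he <;> simp [Concept.IsEL, Role.IsName]

theorem Program.isEL_of_mem_inclusions {u : Program} {p : Concept × Concept}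
    (hp : p ∈ u.inclusions) : p.1.IsEL ∧ p.2.IsEL := by
  obtain rfl | ⟨a, b, -, rfl⟩ | ⟨d, -, q, hq, a, b, rfl⟩ := mem_inclusions.1 hp
  · simp [Concept.IsEL, Role.IsName]
  · simp [Concept.IsEL, Role.IsName]
  · obtain ⟨h₁, h₂⟩ := isEL_of_mem_existential hq
    exact ⟨⟨trivial, h₁⟩, trivial, trivial, h₂⟩

theorem Program.over_isEL_of_mem_violations {u : Program} {q : List Atom}
    (hq : q ∈ u.violations) : ∀ α ∈ q, α.Over Concept.IsEL := by
  obtain ⟨d, -, e, he, a, b, c, -, rfl⟩ := mem_violations.1 hq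
  simp [violation, Atom.Over, Concept.IsEL, isEL_of_mem_equational he]

theorem isEL_numConcept (m : ℕ) : (numConcept m).IsEL := by
  induction m with
  | zero => exact ⟨trivial, trivial⟩
  | succ m ih => exact ⟨trivial, trivial, ⟨trivial, trivial, trivial⟩, trivial, ih⟩

theorem isEL_inputConcept (m : ℕ) : (inputConcept m).IsEL :=
  ⟨trivial, trivial, trivial, ⟨trivial, trivial, trivial⟩, trivial, isEL_numConcept m⟩

theorem Atom.Over.mono {P Q : Concept → Prop} (h : ∀ C, P C → Q C) {α : Atom} (hα : α.Over P) :
    α.Over Q := by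
  cases α
  · exact h _ hα
  · trivial

theorem queryGraph_adj {q : List Atom} {r v w} (h : Atom.role r v w ∈ q) (hne : v ≠ w) :
    (queryGraph q).Adj v w :=
  (SimpleGraph.fromRel_adj ..).2 ⟨hne, .inl ⟨r, h⟩⟩

theorem isConnectedCQ_of_reachable {vs : List Var} {q : List Atom} (v₀ : Var)
    (h : ∀ v ∈ vs, (queryGraph q).Reachable v₀ v) : IsConnectedCQ vs q :=
  fun v hv w hw => (h v hv).symm.trans (h w hw)

/-- The role atoms form the path `2`, `1`, `0`, `3`. -/
theorem violation_reachable (e : Concept × Program × Program × Program) (a b c : Fin 3) {v : Var}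
    (hv : v = 0 ∨ v = 1 ∨ v = 2 ∨ v = 3) : (queryGraph (violation e a b c)).Reachable 0 v := by
  have h₁ : (queryGraph (violation e a b c)).Reachable 0 1 :=
    (queryGraph_adj (r := e.2.1.roleName) (by simp [violation]) (by decide)).reachable
  have h₂ : (queryGraph (violation e a b c)).Reachable 1 2 :=
    (queryGraph_adj (r := e.2.2.1.roleName) (by simp [violation]) (by decide)).reachable
  have h₃ : (queryGraph (violation e a b c)).Reachable 0 3 :=
    (queryGraph_adj (r := e.2.2.2.roleName) (by simp [violation]) (by decide)).reachable
  obtain rfl | rfl | rfl | rfl := hv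
  · exact .refl _
  · exact h₁
  · exact h₁.trans h₂
  · exact h₃

theorem violation_hasVar (e : Concept × Program × Program × Program) (a b c : Fin 3) {v : Var} :
    (∃ α ∈ violation e a b c, α.HasVar v) ↔ v = 0 ∨ v = 1 ∨ v = 2 ∨ v = 3 := by
  simp only [violation, List.exists_mem_cons_iff, Atom.HasVar, List.not_mem_nil, false_and,
    exists_false, or_false]
  tauto

/-- All statements are well-formed and belong to the fragment. -/
def OntologyInFragment (P : Concept → Prop) (ops : Set Operator) (O : Ontology) : Prop :=
  ∀ s ∈ O, s.WellFormed ∧ s.InFragment P ops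

theorem Program.conceptAbstractions_inFragment {P : Concept → Prop} (hP : ∀ C, C.IsEL → P C)
    {ops : Set Operator} (hops : Operator.ca ∈ ops) (u : Program) :
    OntologyInFragment P ops u.conceptAbstractions := by
  have hbot : botConcept.IsEL := ⟨trivial, trivial⟩
  simp only [OntologyInFragment, conceptAbstractions, List.forall_mem_cons, List.forall_mem_map]
  refine ⟨⟨⟨by simp, ⟨by simp, by simp [Atom.HasVar]⟩,
    isConnectedCQ_of_reachable 0 (by simp)⟩, hops, hP _ hbot, ?_⟩, fun q hq =>
      ⟨?_, hops, hP _ hbot, fun α hα => (over_isEL_of_mem_violations hq α hα).mono hP⟩⟩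
  · simpa [Atom.Over] using hP _ hbot
  · obtain ⟨d, -, e, he, a, b, c, -, rfl⟩ := mem_violations.1 hq
    refine ⟨by simp, ⟨by decide, fun v => ?_⟩, isConnectedCQ_of_reachable 0 fun v hv => ?_⟩
    · rw [violation_hasVar]
      simp only [List.mem_cons, List.not_mem_nil, or_false]
    · refine violation_reachable e a b c ?_
      simp only [List.mem_cons, List.not_mem_nil, or_false] at hv
      tauto

theorem Program.roleAbstractions_inFragment {P : Concept → Prop} (hP : ∀ C, C.IsEL → P C)
    {ops : Set Operator} (hops : Operator.ra ∈ ops) (u : Program) :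
    OntologyInFragment P ops u.roleAbstractions := by
  simp only [OntologyInFragment, roleAbstractions, List.forall_mem_cons, List.forall_mem_map]
  refine ⟨⟨⟨by simp, by simp, ⟨by simp, by simp [Atom.HasVar]⟩,
    isConnectedCQ_of_reachable 0 ?_⟩, hops, trivial, by simp [Atom.Over]⟩, fun q hq =>
      ⟨?_, hops, trivial, fun α hα => (over_isEL_of_mem_violations hq α hα).mono hP⟩⟩
  · have h : (queryGraph [.role 0 0 1]).Reachable 0 1 :=
      (queryGraph_adj (r := 0) (by simp) (by decide)).reachable
    simpa using h
  · obtain ⟨d, -, e, he, a, b, c, -, rfl⟩ := mem_violations.1 hq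
    refine ⟨by simp, by simp, ⟨by decide, fun v => ?_⟩,
      isConnectedCQ_of_reachable 0 fun v hv => ?_⟩
    · rw [violation_hasVar]
      simp only [List.cons_append, List.nil_append, List.mem_cons, List.not_mem_nil, or_false]
      tauto
    · refine violation_reachable e a b c ?_
      simp only [List.cons_append, List.nil_append, List.mem_cons, List.not_mem_nil,
        or_false] at hv
      tauto

theorem emptyRoleALC_inFragment (ops : Set Operator) :
    OntologyInFragment Concept.IsALC ops emptyRoleALC := by
  simp [OntologyInFragment, emptyRoleALC, Statement.WellFormed, Statement.InFragment,
    Concept.IsALC, Role.IsName]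

theorem emptyRoleEL_inFragment {ops : Set Operator} (hops : Operator.rr ∈ ops) :
    OntologyInFragment Concept.IsEL ops emptyRoleEL := by
  simp [OntologyInFragment, emptyRoleEL, Statement.WellFormed, Statement.InFragment,
    Concept.IsEL, Role.IsName, IsFullCQ, Atom.HasVar, Atom.Over, hops,
    or_assoc]

theorem Program.toInstance_inFragment {P : Concept → Prop} (hP : ∀ C, C.IsEL → P C)
    {ops : Set Operator} {O : Ontology} (hO : OntologyInFragment P ops O) (u : Program) (m : ℕ) :
    (u.toInstance O m).InFragment P ops := by
  refine ⟨?_, hP _ (isEL_inputConcept m)⟩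
  simp only [toInstance, ontology, List.forall_mem_append, List.forall_mem_map]
  refine ⟨fun p hp => ?_, hO⟩
  obtain ⟨h₁, h₂⟩ := isEL_of_mem_inclusions hp
  exact ⟨trivial, hP _ h₁, hP _ h₂⟩

/-! ### The reduction is computable -/

theorem primrec_pair {f g : ℕ × ℕ → ℕ} (hf : Primrec f) (hg : Primrec g) :
    Primrec fun x => Nat.pair (f x) (g x) :=
  Primrec₂.natPair.comp hf hg

/-- In the recursion step only the parity tag and the code `k` of the predecessor vary; all else is
constant. -/
theorem primrec_code_numConcept : Primrec fun m => (numConcept m).code := by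
  have h := Primrec.nat_rec₁ (numConcept 0).code
    (f := fun m k => Nat.pair 3 (Nat.pair (Nat.pair 1 ((m + 1) % 2)) (Nat.pair 3
      (Nat.pair nodeConcept.code (Nat.pair 3 (Nat.pair
        (Program.ex .fst (.conj (.name 2) leafConcept)).code
        (Nat.pair 5 (Nat.pair (Role.name Program.snd.roleName).code k))))))))
    (by
      have hm : Primrec fun x : ℕ × ℕ => (x.1 + 1) % 2 :=
        Primrec.nat_mod.comp (Primrec.succ.comp Primrec.fst) (Primrec.const 2)
      have hc := fun n : ℕ => Primrec.const (α := ℕ × ℕ) n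
      exact primrec_pair (hc _) (primrec_pair (primrec_pair (hc _) hm) (primrec_pair (hc _)
        (primrec_pair (hc _) (primrec_pair (hc _) (primrec_pair (hc _)
          (primrec_pair (hc _) (primrec_pair (hc _) Primrec.snd))))))))
  refine h.of_eq fun m => ?_
  induction m with
  | zero => rfl
  | succ m ih =>
    simp only [numConcept, Concept.code, ← ih]

theorem primrec_code_inputConcept : Primrec fun m => (inputConcept m).code := by
  have h (n : ℕ) {f : ℕ → ℕ} (hf : Primrec f) : Primrec fun m => Nat.pair n (f m) :=
    Primrec₂.natPair.comp (Primrec.const n) hf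
  exact h _ (h _ (h _ (h _ (h _ (h _ (h _ (h _ (h _ (h _ primrec_code_numConcept)))))))))

/-- With `u` fixed, the ontology does not depend on the input, so only the code of the input concept
has to be computed. -/
theorem Program.computable_code_toInstance (u : Program) (O : Ontology) :
    Computable fun m => (u.toInstance O m).code := by
  refine Primrec.to_comp ?_
  refine Primrec.encode.comp (Primrec.list_cons.comp (Primrec.const _)
    (Primrec.list_cons.comp primrec_code_inputConcept (Primrec.const [0])))

/-! ### Undecidability -/

theorem not_satDecidable {P : Concept → Prop} (hP : ∀ C, C.IsEL → P C) {ops : Set Operator}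
    {E : Ontology} {F : Program → Ontology} (hE : EmptiesRole E)
    (hF : ∀ u, ForbidsViolations u (F u))
    (hE' : ∀ J : Interp, ∀ s ∈ E, J.twoLevels.Satisfies s)
    (hF' : ∀ u J, Program.IsModel u J → ∀ s ∈ F u, J.twoLevels.Satisfies s)
    (hEops : OntologyInFragment P ops E) (hFops : ∀ u, OntologyInFragment P ops (F u)) :
    ¬ SatDecidable P ops := by
  rintro ⟨p, hp, hpX⟩
  obtain ⟨u, hu⟩ := exists_program_not_computablePred
  -- Satisfiability expresses divergence, so a decision procedure is negated to decide the domain of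
  -- `u`.
  refine hu (ComputablePred.of_eq (ComputablePred.not (ComputablePred.computable_of_manyOneReducible
    ⟨_, u.computable_code_toInstance (E ++ F u), fun m => Iff.rfl⟩ hp)) fun m => ?_)
  rw [hpX _ (u.toInstance_inFragment hP (List.forall_mem_append.2 ⟨hEops, hFops u⟩) m),
    Program.satisfiable_iff hE (hF u)
      (fun J hJ => List.forall_mem_append.2 ⟨hE' J, hF' u J hJ⟩), not_not]

end AbsDL

theorem theorem6 :
    ¬ AbsDL.SatDecidable AbsDL.Concept.IsALC {AbsDL.Operator.ca} ∧
    ¬ AbsDL.SatDecidable AbsDL.Concept.IsALC {AbsDL.Operator.ra} ∧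
    ¬ AbsDL.SatDecidable AbsDL.Concept.IsEL {AbsDL.Operator.rr, AbsDL.Operator.ca} ∧
    ¬ AbsDL.SatDecidable AbsDL.Concept.IsEL {AbsDL.Operator.rr, AbsDL.Operator.ra} := by
  open AbsDL in
  exact ⟨
    not_satDecidable (fun _ => Concept.IsEL.isALC) emptiesRole_ALC forbidsViolations_ca
      satisfies_emptyRoleALC (fun _ _ hJ => hJ.satisfies_conceptAbstractions)
      (emptyRoleALC_inFragment _)
      (Program.conceptAbstractions_inFragment (fun _ => Concept.IsEL.isALC) (by simp)),
    not_satDecidable (fun _ => Concept.IsEL.isALC) emptiesRole_ALC forbidsViolations_ra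
      satisfies_emptyRoleALC (fun _ _ hJ => hJ.satisfies_roleAbstractions)
      (emptyRoleALC_inFragment _)
      (Program.roleAbstractions_inFragment (fun _ => Concept.IsEL.isALC) (by simp)),
    not_satDecidable (fun _ => _root_.id) emptiesRole_EL forbidsViolations_ca
      satisfies_emptyRoleEL (fun _ _ hJ => hJ.satisfies_conceptAbstractions)
      (emptyRoleEL_inFragment (by simp))
      (Program.conceptAbstractions_inFragment (fun _ => _root_.id) (by simp)),
    not_satDecidable (fun _ => _root_.id) emptiesRole_EL forbidsViolations_ra
      satisfies_emptyRoleEL (fun _ _ hJ => hJ.satisfies_roleAbstractions)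
      (emptyRoleEL_inFragment (by simp))
      (Program.roleAbstractions_inFragment (fun _ => _root_.id) (by simp))⟩
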